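/- Let $T>0$ and let $\psi:[0,\infty)\to(0,\infty)$ be nondecreasing. Let $\Omega_\psi$ be the set of càdlàg functions $\omega:[0,T]\to\mathbb R$ whose jumps $\Delta\omega(t)=\omega(t)-\omega(t-)$ satisfy $|\Delta\omega(t)|\le\psi\bigl(\sup_{s\in[0,t)}|\omega(s)|\bigr)$ for all $t\in(0,T]$. For $t\in[0,T]$ let $\mathcal F_t$ be the universal completion of the $\sigma$-algebra on $\Omega_\psi$ generated by the evaluations $\omega\mapsto\omega(s)$, $s\in[0,t]$; stopping times $\tau:\Omega_\psi\to[0,T]\cup\{\infty\}$ and the $\sigma$-algebras $\mathcal F_\tau$ are taken with respect to $(\mathcal F_t)$. *Typical paths.* A simple trading strategy $G$ consists of stopping times $\tau_1\le\tau_2\le\cdots$, only finitely many of them finite for each $\omega$, and bounded $\mathcal F_{\tau_n}$-measurable functions $h_n:\Omega_\psi\to\mathbb R$; with initial capital $\alpha\in\mathbb R$ its capital process is $\mathcal K^{G,\alpha}_t(\omega)=\alpha+\sum_{n\ge1}h_n(\omega)\bigl(\omega(\tau_{n+1}\wedge t)-\omega(\tau_n\wedge t)\bigr)$. A nonnegative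 capital process is a sum $S=\sum_n\mathcal K^{G_n,\alpha_n}$ (with values in $[0,\infty]$) in which every $\mathcal K^{G_n,\alpha_n}$ is nonnegative for all $t$ and $\omega$ and $\sum_n\alpha_n<\infty$; its initial value is $S_0=\sum_n\alpha_n$. A set $E\subseteq\Omega_\psi$ is null if the infimum of $S_0$, over the nonnegative capital processes $S$ with $S_T(\omega)\ge\mathbf 1_E(\omega)$ for all $\omega\in\Omega_\psi$, is $0$. A property holds for typical $\omega$ if the set of $\omega\in\Omega_\psi$ where it fails is null. *Quadratic variation.* A partition of $[0,T]$ is a sequence $0=\pi_0<\pi_1<\cdots<\pi_m\le T$, continued by $\pi_k=\infty$ for $k>m$. A sequence $\pi=(\pi^n)_{n\ge0}$ of partitions is nested if every element of $\pi^{n}$ is an element of $\pi^{n+1}$, for all $n\ge0$. It exhausts $\omega$ if every $t\in(0,T]$ with $\Delta\omega(t)\ne0$ belongs to some $\pi^n$ and every open interval $(u,v)\subseteq[0,T]$ on which $\omega$ is not constant contains an element of some $\pi^n$. Put $A^{n,\pi}_t=\sum_{k\ge1}\bigl(\omega(\pi^n_k\wedge t)-\omega(\pi^n_{k-1}\wedge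 t)\bigr)^2$, $t\in[0,T]$. The quadratic variation of $\omega$ along $\pi$ is the limit of $A^{n,\pi}$ in the space of càdlàg functions on $[0,T]$ with the uniform metric, if it exists. *Dyadic type.* An array $\iota=(\iota^n_k)_{n,k\ge0}$ of stopping times such that $\iota^n(\omega)=(\iota^n_k(\omega))_k$ is a partition of $[0,T]$ for all $n$ and $\omega$ is of dyadic type if there are a polynomial $p$ and a constant $C>0$ such that (a) for every $\omega\in\Omega_\psi$ the sequence $\iota(\omega)=(\iota^n(\omega))_n$ is nested and exhausts $\omega$; (b) for all $\omega\in\Omega_\psi$, $n\ge0$ and $0\le s<t\le T$ with $|\omega(t)-\omega(s)|>C2^{-n}$ there is $k$ with $\iota^n_k(\omega)\in(s,t]$; (c) for typical $\omega$, from some $n$ on, the number of $k$ with $\iota^n_k(\omega)<\infty$ is at most $p(n)2^{2n}$. **Proposition.** Let $\iota$ and $\kappa$ be arrays of stopping times on $\Omega_\psi$ that are both of dyadic type. Then there is $r\in(0,1)$ such that for typical $\omega\in\Omega_\psi$: 1. $\omega$ has quadratic variation along $\iota(\omega)$ and along $\kappa(\omega)$, and the two are the same function on $[0,T]$; 2.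 there is a constant $K$ (depending on $\omega$) with $\sup_{t\in[0,T]}\bigl|A^{n,\iota(\omega)}_t-A^{n,\kappa(\omega)}_t\bigr|\le K r^n$ for all $n\ge0$. -/

import Mathlib

open Set Filter Topology MeasureTheory
open scoped ENNReal

noncomputable section

namespace PriceGame

/-- The time interval `[0, T]`. -/
abbrev Time (T : ℝ) : Type := Set.Icc (0 : ℝ) T

/-! ### Càdlàg functions and the sample space -/

/-- `f : [0, T] → ℝ` is right-continuous and has (finite) left limits. -/
def IsCadlag {T : ℝ} (f : Time T → ℝ) : Prop :=
  ∀ t : Time T, ContinuousWithinAt f (Set.Ici t) t ∧ ∃ l : ℝ, Tendsto f (𝓝[<] t) (𝓝 l)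

/-- The jump `Δf(t) = f(t) - f(t-)`. -/
def jump {T : ℝ} (f : Time T → ℝ) (t : Time T) : ℝ :=
  f t - Function.leftLim f t

/-- The sample space `Ω_ψ`: the càdlàg functions `ω` on `[0, T]` with
`|Δω(t)| ≤ ψ (sup_{s < t} |ω(s)|)` for all `t ∈ (0, T]`. -/
structure PricePath (T : ℝ) (ψ : ℝ → ℝ) where
  toFun : Time T → ℝ
  cadlag : IsCadlag toFun
  jump_le : ∀ t : Time T, 0 < (t : ℝ) → |jump toFun t| ≤ ψ (⨆ s : Set.Iio t, |toFun s|)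

instance (T : ℝ) (ψ : ℝ → ℝ) : CoeFun (PricePath T ψ) (fun _ => Time T → ℝ) :=
  ⟨PricePath.toFun⟩

/-! ### The filtration -/

/-- The universal completion of a σ-algebra `m`: the sets that are measurable with respect to the
completion of every probability measure on `m`. -/
@[reducible] def universalCompletion {Ω : Type*} (m : MeasurableSpace Ω) : MeasurableSpace Ω where
  MeasurableSet' s := ∀ μ : @Measure Ω m, IsProbabilityMeasure μ → NullMeasurableSet s μ
  measurableSet_empty := fun _ _ => MeasurableSet.empty.nullMeasurableSet
  measurableSet_compl := fun _ hs μ hμ => (hs μ hμ).compl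
  measurableSet_iUnion := fun _ hs μ hμ => NullMeasurableSet.iUnion fun i => hs i μ hμ

theorem universalCompletion_mono {Ω : Type*} {m₁ m₂ : MeasurableSpace Ω} (h : m₁ ≤ m₂) :
    universalCompletion m₁ ≤ universalCompletion m₂ := by
  intro s hs μ hμ
  have hp : IsProbabilityMeasure (μ.trim h) :=
    ⟨by rw [trim_measurableSet_eq h MeasurableSet.univ]; exact hμ.measure_univ⟩
  obtain ⟨t, ht, hst⟩ := hs (μ.trim h) hp
  exact ⟨t, h t ht, ae_eq_of_ae_eq_trim hst⟩

/-- `ℱ°_t`: the smallest σ-algebra making all evaluations `ω ↦ ω(s)`, `s ≤ t`, measurable. -/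
@[reducible] def rawSigma (T : ℝ) (ψ : ℝ → ℝ) (t : Time T) : MeasurableSpace (PricePath T ψ) :=
  ⨆ s : Set.Iic t, MeasurableSpace.comap (fun ω : PricePath T ψ => ω s) (borel ℝ)

theorem rawSigma_mono (T : ℝ) (ψ : ℝ → ℝ) : Monotone (rawSigma T ψ) := fun _ _ h =>
  iSup_le fun s => le_iSup_of_le (⟨s.1, le_trans s.2 h⟩ : Set.Iic _) le_rfl

/-- The filtration `(ℱ_t)`, where `ℱ_t` is the universal completion of `ℱ°_t`. -/
def pathFiltration (T : ℝ) (ψ : ℝ → ℝ) :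
    Filtration (Time T) (universalCompletion (⨆ t, rawSigma T ψ t)) where
  seq t := universalCompletion (rawSigma T ψ t)
  mono' := fun _ _ h => universalCompletion_mono (rawSigma_mono T ψ h)
  le' := fun t => universalCompletion_mono (le_iSup (rawSigma T ψ) t)

/-! ### Trading strategies and upper price -/

/-- `τ ∧ t` for a time `τ ∈ [0, T] ∪ {∞}` and `t ∈ [0, T]`. -/
def stopAt {T : ℝ} (τ : WithTop (Time T)) (t : Time T) : Time T :=
  min (τ.untopD t) t

/-- A simple trading strategy: stopping times `τ 0 ≤ τ 1 ≤ ⋯`, for each `ω` only finitely many of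
them finite, and bounded `ℱ_{τ n}`-measurable positions `h n`. -/
structure SimpleStrategy (T : ℝ) (ψ : ℝ → ℝ) where
  τ : ℕ → PricePath T ψ → WithTop (Time T)
  isStoppingTime : ∀ n, IsStoppingTime (pathFiltration T ψ) (τ n)
  mono : ∀ n ω, τ n ω ≤ τ (n + 1) ω
  finite : ∀ ω, {n | τ n ω ≠ ⊤}.Finite
  h : ℕ → PricePath T ψ → ℝ
  bounded : ∀ n, ∃ C : ℝ, ∀ ω, |h n ω| ≤ C
  measurable : ∀ n, Measurable[(isStoppingTime n).measurableSpace] (h n)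

/-- The simple capital process of the strategy `G` with initial capital `α`
(the sum has finitely many nonzero terms). -/
def SimpleStrategy.capital {T : ℝ} {ψ : ℝ → ℝ} (G : SimpleStrategy T ψ) (α : ℝ) (t : Time T)
    (ω : PricePath T ψ) : ℝ :=
  α + ∑' n : ℕ, G.h n ω * (ω (stopAt (G.τ (n + 1) ω) t) - ω (stopAt (G.τ n ω) t))

/-- The data of a nonnegative capital process: countably many nonnegative simple capital
processes whose initial capitals have a finite sum. -/
structure NonnegCapital (T : ℝ) (ψ : ℝ → ℝ) where
  G : ℕ → SimpleStrategy T ψ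
  α : ℕ → ℝ
  nonneg : ∀ n t ω, 0 ≤ (G n).capital (α n) t ω
  summable : Summable α

/-- The value `S_t(ω) ∈ [0, ∞]` of a nonnegative capital process. -/
def NonnegCapital.value {T : ℝ} {ψ : ℝ → ℝ} (S : NonnegCapital T ψ) (t : Time T)
    (ω : PricePath T ψ) : ℝ≥0∞ :=
  ∑' n : ℕ, ENNReal.ofReal ((S.G n).capital (S.α n) t ω)

/-- The initial value `S_0`, which is the sum of the initial capitals `α n`. -/
def NonnegCapital.initial {T : ℝ} {ψ : ℝ → ℝ} (S : NonnegCapital T ψ) : ℝ≥0∞ :=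
  ENNReal.ofReal (∑' n : ℕ, S.α n)

/-- The upper price of `E`: the infimum of `S_0` over the nonnegative capital processes `S` with
`S_T ≥ 1_E` everywhere on the sample space. -/
def upperPrice {T : ℝ} {ψ : ℝ → ℝ} (E : Set (PricePath T ψ)) : ℝ≥0∞ :=
  sInf {x | ∃ S : NonnegCapital T ψ,
    (∀ (ω : PricePath T ψ) (t : Time T), (t : ℝ) = T → E.indicator 1 ω ≤ S.value t ω) ∧
      x = S.initial}

/-- A set is null if its upper price is zero. -/
def IsNull {T : ℝ} {ψ : ℝ → ℝ} (E : Set (PricePath T ψ)) : Prop := upperPrice E = 0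

/-- `P` holds for typical `ω` if the set of `ω` where it fails is null. -/
def Typically {T : ℝ} {ψ : ℝ → ℝ} (P : PricePath T ψ → Prop) : Prop := IsNull {ω | ¬ P ω}

/-! ### Partitions and quadratic variation -/

/-- A partition `0 = π 0 < ⋯ < π m ≤ T`, continued by `π k = ∞` for `k > m`. -/
def IsPartition {T : ℝ} (π : ℕ → WithTop (Time T)) : Prop :=
  (∃ z : Time T, (z : ℝ) = 0 ∧ π 0 = z) ∧
    ∃ m : ℕ, (∀ k < m, π k < π (k + 1)) ∧ π m ≠ ⊤ ∧ ∀ k, m < k → π k = ⊤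

/-- Each element of `π n` is an element of `π (n + 1)`. -/
def IsNested {T : ℝ} (π : ℕ → ℕ → WithTop (Time T)) : Prop :=
  ∀ n k, π n k ≠ ⊤ → ∃ k', π (n + 1) k' = π n k

/-- `π` exhausts `f`: it contains all jump times of `f` in `(0, T]`, and it has a point in each
open interval in which `f` is not constant. -/
def Exhausts {T : ℝ} (π : ℕ → ℕ → WithTop (Time T)) (f : Time T → ℝ) : Prop :=
  (∀ t : Time T, 0 < (t : ℝ) → jump f t ≠ 0 → ∃ n k, π n k = t) ∧
    ∀ u v : Time T, (∃ s ∈ Set.Ioo u v, ∃ s' ∈ Set.Ioo u v, f s ≠ f s') →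
      ∃ n k, ∃ t ∈ Set.Ioo u v, π n k = t

/-- For a partition `π = π^n`, the `n`th approximation `A^{n,π}_t` to the quadratic variation
of `f`. -/
def qvApprox {T : ℝ} (π : ℕ → WithTop (Time T)) (f : Time T → ℝ) (t : Time T) : ℝ :=
  ∑' k : ℕ, (f (stopAt (π (k + 1)) t) - f (stopAt (π k) t)) ^ 2

/-- `A` is the quadratic variation of `f` along `π`: the limit in `D[0, T]`, in the uniform
metric, of the approximations. -/
def HasQuadraticVariation {T : ℝ} (π : ℕ → ℕ → WithTop (Time T)) (f A : Time T → ℝ) : Prop :=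
  IsCadlag A ∧ TendstoUniformly (fun n => qvApprox (π n) f) A atTop

/-- An array `ι n k` of stopping times on `Ω_ψ`, forming a partition for each `n` and `ω`, is of
dyadic type. -/
structure IsDyadicType {T : ℝ} {ψ : ℝ → ℝ} (ι : ℕ → ℕ → PricePath T ψ → WithTop (Time T)) :
    Prop where
  isStoppingTime : ∀ n k, IsStoppingTime (pathFiltration T ψ) (ι n k)
  isPartition : ∀ n ω, IsPartition (fun k => ι n k ω)
  nested : ∀ ω, IsNested (fun n k => ι n k ω)
  exhausts : ∀ ω : PricePath T ψ, Exhausts (fun n k => ι n k ω) ω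
  fine : ∃ C : ℝ, 0 < C ∧ ∀ (ω : PricePath T ψ) (n : ℕ) (s t : Time T), s < t →
    C / 2 ^ n < |ω t - ω s| → ∃ k, ∃ u ∈ Set.Ioc s t, ι n k ω = u
  card_le : ∃ p : Polynomial ℝ, Typically fun ω : PricePath T ψ =>
    ∀ᶠ n : ℕ in atTop, ({k | ι n k ω ≠ ⊤}.ncard : ℝ) ≤ p.eval (n : ℝ) * 2 ^ (2 * n)

end PriceGame

end

open PriceGame

namespace PriceGame

/-! ### Stopping at a fixed time -/

/-! For a fixed level, let `a` and `b` be two partitions that are both fine at scale `ε`, and let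
`D` be the difference of the two approximations. Since `(y - z)² - (x - z)² = y² - x² - 2z(y - x)`,
the squares cancel in `D`. Along the merged partition `D` is thus an integral against the path,
whose integrand is twice the difference of the path's values at the last points of `b` and `a`;
fineness bounds it by `δ = 4ε` (`qvDiff_step`, `abs_qvPosition_le`).

Consequently `D² - δ²ω²` is, up to a nonincreasing term, the gain of a simple strategy
(`sq_sub_le_sum_bet`). The strategy stops once `|D| ≥ l` or `|ω| ≥ c`. Fineness and the jump bound
keep `|ω|` below some `B` up to and including the stopping time, so capital `δ²B²` keeps the account
nonnegative. If `|ω|` stays below `c` and `|D|` reaches `l`, the account ends at `l²` or more.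
Normalised, that event costs at most `δ²B²/l²` (`exists_strategy_of_isFine`).

With `ε = C / 2 ^ n` and `l = (3/4) ^ n` the cost is a constant times `(4/9) ^ n`, which is
summable, so a Borel–Cantelli argument and a countable union over `c` give
`isNull_frequently_qvDiff`. It is used twice: `ι` against `κ` yields the rate, and level `n + 1` of
`ι` against level `n` makes the approximations uniformly Cauchy. Uniform limits of càdlàg functions
are càdlàg, and the rate transfers the limit to `κ`. -/

theorem coe_stopAt {T : ℝ} (τ : WithTop (Time T)) (t : Time T) :
    ((stopAt τ t : Time T) : WithTop (Time T)) = min τ t := by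
  induction τ using WithTop.recTopCoe with
  | top => simp [stopAt]
  | coe u => simp [stopAt]

theorem stopAt_of_le {T : ℝ} {τ : WithTop (Time T)} {t : Time T} (h : (t : WithTop (Time T)) ≤ τ) :
    stopAt τ t = t := by
  rw [← WithTop.coe_inj, coe_stopAt, min_eq_right h]

theorem coe_stopAt_of_ge {T : ℝ} {τ : WithTop (Time T)} {t : Time T}
    (h : τ ≤ (t : WithTop (Time T))) : ((stopAt τ t : Time T) : WithTop (Time T)) = τ := by
  rw [coe_stopAt, min_eq_left h]

theorem stopAt_coe_of_le {T : ℝ} {u t : Time T} (h : u ≤ t) :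
    stopAt (u : WithTop (Time T)) t = u := by
  rw [← WithTop.coe_inj, coe_stopAt_of_ge (WithTop.coe_le_coe.2 h)]

theorem stopAt_top {T : ℝ} (t : Time T) : stopAt ⊤ t = t := stopAt_of_le le_top

theorem stopAt_stopAt {T : ℝ} (σ τ : WithTop (Time T)) (t : Time T) :
    stopAt σ (stopAt τ t) = stopAt (min σ τ) t := by
  rw [← WithTop.coe_inj, coe_stopAt, coe_stopAt, coe_stopAt, min_assoc]

theorem stopAt_mono_left {T : ℝ} {σ τ : WithTop (Time T)} (h : σ ≤ τ) (t : Time T) :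
    stopAt σ t ≤ stopAt τ t := by
  rw [← WithTop.coe_le_coe, coe_stopAt, coe_stopAt]
  exact min_le_min_right _ h

/-! ### Increasing sequences of times -/

theorem exists_le_lt_succ {α : Type*} [LinearOrder α] {a : ℕ → α} {s : α} {N : ℕ} (h0 : a 0 ≤ s)
    (hN : s < a N) : ∃ k, a k ≤ s ∧ s < a (k + 1) := by
  classical
  have hex : ∃ n, s < a n := ⟨N, hN⟩
  obtain ⟨k, hk⟩ : ∃ k, Nat.find hex = k + 1 := by
    refine Nat.exists_eq_succ_of_ne_zero fun h => ?_
    have := Nat.find_spec hex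
    rw [h] at this
    exact absurd h0 (not_le.2 this)
  refine ⟨k, not_lt.1 (Nat.find_min hex (by omega)), ?_⟩
  rw [← hk]
  exact Nat.find_spec hex

theorem IsPartition.monotone {T : ℝ} {π : ℕ → WithTop (Time T)} (h : IsPartition π) :
    Monotone π := by
  obtain ⟨-, m, h1, -, h3⟩ := h
  refine monotone_nat_of_le_succ fun n => ?_
  rcases lt_or_ge n m with hn | hn
  · exact (h1 n hn).le
  · rw [h3 (n + 1) (by omega)]
    exact le_top

theorem IsPartition.exists_top {T : ℝ} {π : ℕ → WithTop (Time T)} (h : IsPartition π) :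
    ∃ N, ∀ k, N ≤ k → π k = ⊤ := by
  obtain ⟨-, m, -, -, h3⟩ := h
  exact ⟨m + 1, fun k hk => h3 k (by omega)⟩

theorem IsPartition.zero_le {T : ℝ} {π : ℕ → WithTop (Time T)} (h : IsPartition π) (s : Time T) :
    π 0 ≤ s := by
  obtain ⟨⟨z, hz, h0⟩, -⟩ := h
  rw [h0, WithTop.coe_le_coe, ← Subtype.coe_le_coe, hz]
  exact s.2.1

theorem IsPartition.exists_index {T : ℝ} {π : ℕ → WithTop (Time T)} (h : IsPartition π)
    (s : Time T) : ∃ k, π k ≤ s ∧ (s : WithTop (Time T)) < π (k + 1) := by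
  obtain ⟨N, hN⟩ := h.exists_top
  exact exists_le_lt_succ (h.zero_le s) (by rw [hN N le_rfl]; exact WithTop.coe_lt_top s)

/-! ### Merging two increasing sequences -/

/-- The increasing enumeration (with repetitions) of the terms of two increasing sequences. -/
noncomputable def merge {T : ℝ} (a b : ℕ → WithTop (Time T)) (j : ℕ) : WithTop (Time T) :=
  (Finset.range (j + 1)).inf fun i => max (a i) (b (j - i))

section Merge

variable {T : ℝ} {a b : ℕ → WithTop (Time T)}

theorem merge_le {i j : ℕ} (h : i ≤ j) : merge a b j ≤ max (a i) (b (j - i)) :=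
  Finset.inf_le (f := fun i => max (a i) (b (j - i))) (Finset.mem_range.2 (by omega))

theorem exists_merge_eq (a b : ℕ → WithTop (Time T)) (j : ℕ) :
    ∃ i ≤ j, merge a b j = max (a i) (b (j - i)) := by
  obtain ⟨i, hi, h⟩ := Finset.exists_mem_eq_inf (Finset.range (j + 1)) ⟨0, by simp⟩
    fun i => max (a i) (b (j - i))
  exact ⟨i, by simpa [Nat.lt_succ_iff] using hi, h⟩

theorem merge_monotone (ha : Monotone a) (hb : Monotone b) : Monotone (merge a b) := by
  refine monotone_nat_of_le_succ fun j => ?_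
  obtain ⟨i, hi, h⟩ := exists_merge_eq a b (j + 1)
  rw [h]
  rcases Nat.lt_or_ge i (j + 1) with hij | hij
  · exact (merge_le (by omega : i ≤ j)).trans (max_le_max_left _ (hb (by omega)))
  · refine (merge_le (le_refl j)).trans (max_le_max (ha (by omega)) (hb (by omega)))

theorem merge_zero_le {s : WithTop (Time T)} (ha : a 0 ≤ s) (hb : b 0 ≤ s) : merge a b 0 ≤ s :=
  (merge_le le_rfl).trans (max_le ha hb)

theorem exists_merge_top {N M : ℕ} (ha : ∀ k, N ≤ k → a k = ⊤) (hb : ∀ k, M ≤ k → b k = ⊤) (j : ℕ)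
    (hj : N + M ≤ j) : merge a b j = ⊤ := by
  obtain ⟨i, hi, h⟩ := exists_merge_eq a b j
  rw [h]
  rcases le_or_gt N i with hN | hN
  · rw [ha i hN, top_sup_eq]
  · rw [hb _ (by omega), sup_top_eq]

/-- If the minimum defining the `j`th merged time is attained at `i`, a later `a k` has `k ≥ i + 1`.
Raising `i` to `i + 1` keeps the index of `b`, because `j + 1 - (i + 1) = j - i`, and so bounds the
next merged time by `a k`. -/
theorem merge_not_between_left (ha : Monotone a) (j k : ℕ) :
    ¬ (merge a b j < a k ∧ a k < merge a b (j + 1)) := by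
  rintro ⟨h1, h2⟩
  obtain ⟨i, hi, h⟩ := exists_merge_eq a b j
  rw [h, max_lt_iff] at h1
  have hik : i + 1 ≤ k := ha.reflect_lt h1.1
  refine absurd h2 (not_lt.2 ((merge_le (by omega : i + 1 ≤ j + 1)).trans (max_le (ha hik) ?_)))
  rw [show j + 1 - (i + 1) = j - i by omega]
  exact h1.2.le

theorem merge_not_between_right (hb : Monotone b) (j k : ℕ) :
    ¬ (merge a b j < b k ∧ b k < merge a b (j + 1)) := by
  rintro ⟨h1, h2⟩
  obtain ⟨i, hi, h⟩ := exists_merge_eq a b j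
  rw [h, max_lt_iff] at h1
  have hik : j - i + 1 ≤ k := hb.reflect_lt h1.2
  refine absurd h2 (not_lt.2 ((merge_le (by omega : i ≤ j + 1)).trans (max_le h1.1.le (hb ?_))))
  omega

end Merge

/-! ### The approximations to the quadratic variation -/

/-- Every interval `(s, t]` over which `f` changes by more than `ε` contains a point of `π`. -/
noncomputable def IsFine {T : ℝ} (π : ℕ → WithTop (Time T)) (f : Time T → ℝ) (ε : ℝ) : Prop :=
  ∀ s t : Time T, s < t → ε < |f t - f s| → ∃ k, ∃ u ∈ Set.Ioc s t, π k = u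

theorem IsFine.abs_sub_le {T : ℝ} {π : ℕ → WithTop (Time T)} {f : Time T → ℝ} {ε : ℝ}
    (h : IsFine π f ε) (hε : 0 ≤ ε) {s t : Time T} (hst : s ≤ t)
    (hπ : ∀ k, ¬ ((s : WithTop (Time T)) < π k ∧ π k ≤ t)) : |f t - f s| ≤ ε := by
  by_contra! hlt
  rcases hst.eq_or_lt with rfl | hst
  · simp only [sub_self, abs_zero] at hlt
    exact absurd hlt (not_lt.2 hε)
  · obtain ⟨k, u, hu, hk⟩ := h s t hst hlt
    refine hπ k ?_
    rw [hk]
    exact ⟨WithTop.coe_lt_coe.2 hu.1, WithTop.coe_le_coe.2 hu.2⟩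

/-- The value of `f` at the last point of `π` that is at most `τ`; it is zero for `τ = ∞`. -/
noncomputable def lastValue {T : ℝ} (π : ℕ → WithTop (Time T)) (f : Time T → ℝ) (e : Time T)
    (τ : WithTop (Time T)) : ℝ :=
  ∑' k : ℕ, if π k ≤ τ ∧ τ < π (k + 1) then f (stopAt (min (π k) τ) e) else 0

section Increments

variable {T : ℝ} {π : ℕ → WithTop (Time T)} {f : Time T → ℝ}

theorem qvApprox_eq_sum {N : ℕ} (hN : ∀ k, N ≤ k → π k = ⊤) (t : Time T) :
    qvApprox π f t = ∑ k ∈ Finset.range N, (f (stopAt (π (k + 1)) t) - f (stopAt (π k) t)) ^ 2 := by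
  refine tsum_eq_sum fun k hk => ?_
  have hk' : N ≤ k := by simpa using hk
  rw [hN k hk', hN (k + 1) (by omega)]
  simp

theorem lastValue_eq (hπ : Monotone π) {e u : Time T} (hu : u ≤ e) {k : ℕ} (h1 : π k ≤ u)
    (h2 : (u : WithTop (Time T)) < π (k + 1)) : lastValue π f e u = f (stopAt (π k) u) := by
  unfold lastValue
  rw [tsum_eq_single k]
  · rw [if_pos ⟨h1, h2⟩, ← stopAt_stopAt, stopAt_coe_of_le hu]
  · intro j hj
    refine if_neg fun h => hj (le_antisymm ?_ ?_)
    · exact Nat.lt_succ_iff.1 (hπ.reflect_lt (h.1.trans_lt h2))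
    · exact Nat.lt_succ_iff.1 (hπ.reflect_lt (h1.trans_lt h.2))

theorem lastValue_top (e : Time T) : lastValue π f e ⊤ = 0 := by
  simp [lastValue]

theorem IsFine.abs_lastValue_sub_le {ε : ℝ} (h : IsFine π f ε) (hε : 0 ≤ ε) (hπ : IsPartition π)
    {e u : Time T} (hu : u ≤ e) : |lastValue π f e u - f u| ≤ ε := by
  obtain ⟨k, h1, h2⟩ := hπ.exists_index u
  rw [lastValue_eq hπ.monotone hu h1 h2, abs_sub_comm]
  refine h.abs_sub_le hε ?_ fun j hj => ?_
  · rw [← WithTop.coe_le_coe, coe_stopAt]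
    exact min_le_right _ _
  · rw [coe_stopAt_of_ge h1] at hj
    have := hπ.monotone.reflect_lt hj.1
    exact absurd (hj.2.trans_lt h2) (not_lt.2 (hπ.monotone this))

/-- Only the summand of the partition interval containing `u` changes between `u` and `s`. The point
`s` itself may belong to `π`. The part `f s ^ 2 - f u ^ 2` does not depend on `π`, hence disappears
from the difference of two approximations. -/
theorem qvApprox_step (hπ : IsPartition π) {e u s : Time T} (hu : u ≤ e) (hus : u ≤ s)
    (hb : ∀ k, ¬ ((u : WithTop (Time T)) < π k ∧ π k < s)) :
    qvApprox π f s =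
      qvApprox π f u + f s ^ 2 - f u ^ 2 - 2 * lastValue π f e u * (f s - f u) := by
  obtain ⟨k, h1, h2⟩ := hπ.exists_index u
  obtain ⟨N, hN⟩ := hπ.exists_top
  have hs : (s : WithTop (Time T)) ≤ π (k + 1) := not_lt.1 fun h => hb (k + 1) ⟨h2, h⟩
  have hus' : (u : WithTop (Time T)) ≤ s := WithTop.coe_le_coe.2 hus
  rw [lastValue_eq hπ.monotone hu h1 h2, qvApprox_eq_sum hN, qvApprox_eq_sum hN]
  have hk : k ∈ Finset.range N := by
    by_contra hk
    have := hN k (by simpa using hk)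
    rw [this] at h1
    exact absurd h1 (by simp)
  have key : ∑ j ∈ Finset.range N, ((f (stopAt (π (j + 1)) s) - f (stopAt (π j) s)) ^ 2 -
      (f (stopAt (π (j + 1)) u) - f (stopAt (π j) u)) ^ 2) =
      (f s - f (stopAt (π k) u)) ^ 2 - (f u - f (stopAt (π k) u)) ^ 2 := by
    rw [Finset.sum_eq_single_of_mem k hk]
    · rw [stopAt_of_le hs, stopAt_of_le h2.le]
      congr 4
      rw [← WithTop.coe_inj, coe_stopAt_of_ge h1, coe_stopAt_of_ge (h1.trans hus')]
    · intro j _ hj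
      rcases Nat.lt_or_ge j k with hjk | hjk
      · have e1 : ∀ i ≤ k, stopAt (π i) s = stopAt (π i) u := fun i hi => by
          have hi' := (hπ.monotone hi).trans h1
          rw [← WithTop.coe_inj, coe_stopAt_of_ge hi', coe_stopAt_of_ge (hi'.trans hus')]
        rw [e1 j hjk.le, e1 (j + 1) hjk, sub_self]
      · have e1 : ∀ i, k + 1 ≤ i → stopAt (π i) s = s ∧ stopAt (π i) u = u := fun i hi =>
          ⟨stopAt_of_le (hs.trans (hπ.monotone hi)), stopAt_of_le (h2.le.trans (hπ.monotone hi))⟩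
        rw [(e1 j (by omega)).1, (e1 j (by omega)).2, (e1 (j + 1) (by omega)).1,
          (e1 (j + 1) (by omega)).2]
        simp
  rw [Finset.sum_sub_distrib] at key
  linarith

theorem qvApprox_zero (hπ : IsPartition π) {z : Time T} (hz : (z : ℝ) = 0) :
    qvApprox π f z = 0 := by
  have h : ∀ k, stopAt (π k) z = z := fun k => stopAt_of_le <| by
    obtain ⟨⟨z', hz', h0⟩, -⟩ := id hπ
    rw [show z = z' from Subtype.ext (hz.trans hz'.symm), ← h0]
    exact hπ.monotone (Nat.zero_le k)
  simp [qvApprox, h]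

end Increments

/-- The difference of the approximations to the quadratic variation along two partitions. -/
noncomputable def qvDiff {T : ℝ} (a b : ℕ → WithTop (Time T)) (f : Time T → ℝ) (t : Time T) : ℝ :=
  qvApprox a f t - qvApprox b f t

/-- The integrand of which `qvDiff a b f` is the integral with respect to `f`. -/
noncomputable def qvPosition {T : ℝ} (a b : ℕ → WithTop (Time T)) (f : Time T → ℝ) (e : Time T)
    (τ : WithTop (Time T)) : ℝ :=
  2 * (lastValue b f e τ - lastValue a f e τ)

section Pair

variable {T : ℝ} {a b : ℕ → WithTop (Time T)} {f : Time T → ℝ} {e : Time T} {ε : ℝ}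

theorem abs_qvPosition_le (ha : IsPartition a) (hb : IsPartition b) (hε : 0 ≤ ε)
    (hfa : IsFine a f ε) (hfb : IsFine b f ε) (he : ∀ t, t ≤ e) (τ : WithTop (Time T)) :
    |qvPosition a b f e τ| ≤ 4 * ε := by
  induction τ using WithTop.recTopCoe with
  | top => simpa [qvPosition, lastValue_top] using hε
  | coe u =>
    have h1 := abs_le.1 (hfa.abs_lastValue_sub_le hε ha (he u))
    have h2 := abs_le.1 (hfb.abs_lastValue_sub_le hε hb (he u))
    rw [qvPosition, abs_le]
    constructor <;> linarith [h1.1, h1.2, h2.1, h2.2]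

theorem qvDiff_step (ha : IsPartition a) (hb : IsPartition b) (he : ∀ t, t ≤ e) (j : ℕ)
    (t : Time T) :
    qvDiff a b f (stopAt (merge a b (j + 1)) t) = qvDiff a b f (stopAt (merge a b j) t) +
      qvPosition a b f e (merge a b j) *
        (f (stopAt (merge a b (j + 1)) t) - f (stopAt (merge a b j) t)) := by
  have hmono := merge_monotone ha.monotone hb.monotone (Nat.le_succ j)
  rcases le_or_gt (t : WithTop (Time T)) (merge a b j) with h | h
  · rw [stopAt_of_le h, stopAt_of_le (h.trans hmono)]
    simp
  · have hu := coe_stopAt_of_ge h.le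
    have hus : stopAt (merge a b j) t ≤ stopAt (merge a b (j + 1)) t := stopAt_mono_left hmono t
    have hs : ((stopAt (merge a b (j + 1)) t : Time T) : WithTop (Time T)) ≤ merge a b (j + 1) := by
      rw [coe_stopAt]; exact min_le_left _ _
    rw [qvDiff, qvApprox_step ha (he _) hus fun k hk => merge_not_between_left (b := b)
        ha.monotone j k ⟨hu ▸ hk.1, hk.2.trans_le hs⟩,
      qvApprox_step hb (he _) hus fun k hk => merge_not_between_right (a := a)
        hb.monotone j k ⟨hu ▸ hk.1, hk.2.trans_le hs⟩, qvDiff, qvPosition, hu]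
    ring

theorem abs_sub_le_of_merge (ha : IsPartition a) (hε : 0 ≤ ε) (hfa : IsFine a f ε) {j : ℕ}
    {t : Time T} (h1 : merge a b j ≤ t) (h2 : (t : WithTop (Time T)) < merge a b (j + 1)) :
    |f t - f (stopAt (merge a b j) t)| ≤ ε := by
  refine hfa.abs_sub_le hε ?_ fun k hk => ?_
  · rw [← WithTop.coe_le_coe, coe_stopAt]
    exact min_le_right _ _
  · rw [coe_stopAt_of_ge h1] at hk
    exact merge_not_between_left (b := b) ha.monotone j k ⟨hk.1, hk.2.trans_lt h2⟩

end Pair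

/-! ### The gain of the strategy that bets on the squared difference -/

/-- Up to the `j`th time of the merged sequence, `|qvDiff a b f|` stays below `l` and `|f|` stays
below `c` along that sequence. -/
def Active {T : ℝ} (a b : ℕ → WithTop (Time T)) (f : Time T → ℝ) (e : Time T) (l c : ℝ) (j : ℕ) :
    Prop :=
  ∀ i ≤ j, |qvDiff a b f (stopAt (merge a b i) e)| < l ∧ |f (stopAt (merge a b i) e)| < c

open Classical in
/-- The position taken at the `j`th time of the merged sequence: it replicates
`(qvDiff a b f) ^ 2 - δ ^ 2 * f ^ 2` up to an increasing term. -/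
noncomputable def bet {T : ℝ} (a b : ℕ → WithTop (Time T)) (f : Time T → ℝ) (e : Time T)
    (δ l c : ℝ) (j : ℕ) : ℝ :=
  if Active a b f e l c j then
    2 * qvDiff a b f (stopAt (merge a b j) e) * qvPosition a b f e (merge a b j) -
      2 * δ ^ 2 * f (stopAt (merge a b j) e)
  else 0

/-- The gain up to time `t` from the positions `bet`. -/
noncomputable def gain {T : ℝ} (a b : ℕ → WithTop (Time T)) (f : Time T → ℝ) (e : Time T)
    (δ l c : ℝ) (t : Time T) : ℝ :=
  ∑' j : ℕ, bet a b f e δ l c j * (f (stopAt (merge a b (j + 1)) t) - f (stopAt (merge a b j) t))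

section Gain

variable {T : ℝ} {a b : ℕ → WithTop (Time T)} {f : Time T → ℝ} {e : Time T} {ε δ l c : ℝ}

theorem Active.of_le {i j : ℕ} (h : Active a b f e l c j) (hij : i ≤ j) : Active a b f e l c i :=
  fun k hk => h k (hk.trans hij)

theorem abs_bet_le (hl : 0 ≤ l) (hc : 0 ≤ c) (hδ : 0 ≤ δ)
    (hp : ∀ τ, |qvPosition a b f e τ| ≤ δ) (j : ℕ) :
    |bet a b f e δ l c j| ≤ 2 * l * δ + 2 * δ ^ 2 * c := by
  unfold bet
  split_ifs with h
  · obtain ⟨h1, h2⟩ := h j le_rfl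
    refine (abs_sub _ _).trans (add_le_add ?_ ?_)
    · rw [abs_mul, abs_mul, abs_two]
      have := hp (merge a b j)
      gcongr
    · rw [abs_mul, abs_of_nonneg (by positivity : 0 ≤ 2 * δ ^ 2)]
      gcongr
  · rw [abs_zero]
    positivity

theorem coe_stopAt_merge_zero (ha : IsPartition a) (hb : IsPartition b) (t : Time T) :
    ((stopAt (merge a b 0) t : Time T) : ℝ) = 0 := by
  obtain ⟨⟨z, hz, -⟩, -⟩ := id ha
  have h : stopAt (merge a b 0) t ≤ z := by
    rw [← WithTop.coe_le_coe, coe_stopAt]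
    exact (min_le_left _ _).trans (merge_zero_le (ha.zero_le z) (hb.zero_le z))
  exact le_antisymm ((Subtype.coe_le_coe.2 h).trans hz.le) (stopAt (merge a b 0) t).2.1

theorem qvDiff_zero (ha : IsPartition a) (hb : IsPartition b) {z : Time T} (hz : (z : ℝ) = 0) :
    qvDiff a b f z = 0 := by
  rw [qvDiff, qvApprox_zero ha hz, qvApprox_zero hb hz, sub_zero]

theorem exists_merge_eq_top (ha : IsPartition a) (hb : IsPartition b) :
    ∃ N, ∀ j, N ≤ j → merge a b j = ⊤ := by
  obtain ⟨N, hN⟩ := ha.exists_top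
  obtain ⟨M, hM⟩ := hb.exists_top
  exact ⟨N + M, exists_merge_top hN hM⟩

theorem exists_merge_index (ha : IsPartition a) (hb : IsPartition b) (s : Time T) :
    ∃ j, merge a b j ≤ s ∧ (s : WithTop (Time T)) < merge a b (j + 1) := by
  obtain ⟨N, hN⟩ := exists_merge_eq_top ha hb
  exact exists_le_lt_succ (merge_zero_le (ha.zero_le s) (hb.zero_le s))
    (by rw [hN N le_rfl]; exact WithTop.coe_lt_top s)

/-- Expanding both squares over one merged interval with integrand `H` and path increment `Δ`, the
linear terms are exactly the bet, and the remainder `(H² - δ²)Δ²` is at most zero. -/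
theorem sq_sub_le_sum_bet (ha : IsPartition a) (hb : IsPartition b) (he : ∀ t, t ≤ e)
    (hp : ∀ τ, |qvPosition a b f e τ| ≤ δ) (t : Time T) {N : ℕ}
    (hN : ∀ j < N, Active a b f e l c j) :
    qvDiff a b f (stopAt (merge a b N) t) ^ 2 - δ ^ 2 * f (stopAt (merge a b N) t) ^ 2 ≤
      ∑ j ∈ Finset.range N,
        bet a b f e δ l c j * (f (stopAt (merge a b (j + 1)) t) - f (stopAt (merge a b j) t)) := by
  induction N with
  | zero =>
    rw [qvDiff_zero ha hb (coe_stopAt_merge_zero ha hb t), Finset.range_zero, Finset.sum_empty]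
    have : 0 ≤ δ ^ 2 * f (stopAt (merge a b 0) t) ^ 2 := by positivity
    linarith
  | succ N ih =>
    specialize ih fun j hj => hN j (by omega)
    rw [Finset.sum_range_succ, bet, if_pos (hN N (by omega))]
    have hstep := qvDiff_step (f := f) ha hb he N t
    have hmono := merge_monotone ha.monotone hb.monotone (Nat.le_succ N)
    have hpN : qvPosition a b f e (merge a b N) ^ 2 ≤ δ ^ 2 := by
      rw [← sq_abs]
      exact pow_le_pow_left₀ (abs_nonneg _) (hp _) 2
    rcases le_or_gt (t : WithTop (Time T)) (merge a b N) with h | h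
    · rw [stopAt_of_le h, stopAt_of_le (h.trans hmono)] at *
      simpa using ih
    · have hte : stopAt (merge a b N) e = stopAt (merge a b N) t := by
        rw [← WithTop.coe_inj, coe_stopAt_of_ge h.le,
          coe_stopAt_of_ge (h.le.trans (WithTop.coe_le_coe.2 (he t)))]
      rw [hstep, hte]
      set x := f (stopAt (merge a b N) t)
      set y := f (stopAt (merge a b (N + 1)) t)
      -- This is the sign of the second-order remainder.
      have := mul_le_mul_of_nonneg_right hpN (sq_nonneg (y - x))
      nlinarith

/-- `M` is the first inactive index if there is one; otherwise it is an index from which the merged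
times are infinite, so that later increments vanish. -/
theorem exists_gain_eq_sum (ha : IsPartition a) (hb : IsPartition b) (δ l c : ℝ) (t : Time T) :
    ∃ M, (∀ j < M, Active a b f e l c j) ∧
      (¬ Active a b f e l c M ∨ ∀ j, Active a b f e l c j) ∧
      gain a b f e δ l c t = ∑ j ∈ Finset.range M,
        bet a b f e δ l c j *
          (f (stopAt (merge a b (j + 1)) t) - f (stopAt (merge a b j) t)) := by
  classical
  by_cases h : ∀ j, Active a b f e l c j
  · obtain ⟨N, hN⟩ := exists_merge_eq_top ha hb
    refine ⟨N, fun j _ => h j, Or.inr h, tsum_eq_sum fun j hj => ?_⟩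
    have hj' : N ≤ j := by simpa using hj
    rw [hN j hj', hN (j + 1) (by omega), sub_self, mul_zero]
  · push Not at h
    refine ⟨Nat.find h, fun j hj => not_not.1 (Nat.find_min h hj), Or.inl (Nat.find_spec h),
      tsum_eq_sum fun j hj => ?_⟩
    have hj' : Nat.find h ≤ j := by simpa using hj
    rw [bet, if_neg fun hA => Nat.find_spec h (hA.of_le hj'), zero_mul]

theorem gain_nonneg (ha : IsPartition a) (hb : IsPartition b) (he : ∀ t, t ≤ e)
    (hp : ∀ τ, |qvPosition a b f e τ| ≤ δ) {B : ℝ}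
    (hB : ∀ M, (∀ j ≤ M, |f (stopAt (merge a b j) e)| < c) →
      ∀ t, |f (stopAt (merge a b (M + 1)) t)| ≤ B) (t : Time T) :
    0 ≤ δ ^ 2 * B ^ 2 + gain a b f e δ l c t := by
  obtain ⟨M, hM, -, hg⟩ := exists_gain_eq_sum (f := f) (e := e) ha hb δ l c t
  have h := sq_sub_le_sum_bet ha hb he hp t hM
  rw [hg]
  -- For `M = 0` nothing is ever bet; this case is separate because the starting value may exceed
  -- every bound available here.
  rcases M with _ | M
  · rw [Finset.range_zero, Finset.sum_empty]
    positivity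
  · have h2 : f (stopAt (merge a b (M + 1)) t) ^ 2 ≤ B ^ 2 := by
      rw [← sq_abs]
      exact pow_le_pow_left₀ (abs_nonneg _)
        (hB M (fun j hj => (hM j (by omega) j le_rfl).2) t) 2
    have h3 := mul_le_mul_of_nonneg_left h2 (sq_nonneg δ)
    nlinarith [sq_nonneg (qvDiff a b f (stopAt (merge a b (M + 1)) t))]

/-- The extra `δ * ε` in `hbig` pays for passing from `t` to the last merged time before it: in
between, `f` moves by at most `ε` and the integrand is at most `δ`. As `|f| < c` throughout, betting
can only have stopped because the difference reached `l`. -/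
theorem le_gain (ha : IsPartition a) (hb : IsPartition b) (hε : 0 ≤ ε) (hl : 0 < l)
    (hfa : IsFine a f ε) (he : ∀ t, t ≤ e)
    (hp : ∀ τ, |qvPosition a b f e τ| ≤ δ) {B : ℝ} (hcB : c ≤ B) (hc : ∀ t, |f t| < c)
    (hbig : ∃ t, l + δ * ε ≤ |qvDiff a b f t|) :
    l ^ 2 ≤ δ ^ 2 * B ^ 2 + gain a b f e δ l c e := by
  obtain ⟨t, ht⟩ := hbig
  obtain ⟨j, h1, h2⟩ := exists_merge_index ha hb t
  have hte : stopAt (merge a b j) e = stopAt (merge a b j) t := by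
    rw [← WithTop.coe_inj, coe_stopAt_of_ge h1,
      coe_stopAt_of_ge (h1.trans (WithTop.coe_le_coe.2 (he t)))]
  have hj : ¬ Active a b f e l c j := by
    intro hA
    have hD := (hA j le_rfl).1
    have hstep := qvDiff_step (f := f) ha hb he j t
    rw [stopAt_of_le h2.le, ← hte] at hstep
    have hosc := abs_sub_le_of_merge ha hε hfa h1 h2
    rw [← hte] at hosc
    have : |qvDiff a b f t| ≤ |qvDiff a b f (stopAt (merge a b j) e)| + δ * ε := by
      rw [hstep]
      refine (abs_add_le _ _).trans (add_le_add_right ?_ _)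
      rw [abs_mul]
      exact mul_le_mul (hp _) hosc (abs_nonneg _) ((abs_nonneg _).trans (hp ⊤))
    linarith
  obtain ⟨M, hM, hM', hg⟩ := exists_gain_eq_sum (f := f) (e := e) ha hb δ l c e
  have hMA : ¬ Active a b f e l c M := hM'.resolve_right fun h => hj (h j)
  have hDM : l ≤ |qvDiff a b f (stopAt (merge a b M) e)| := by
    by_contra! hlt
    refine hMA fun i hi => ⟨?_, hc _⟩
    rcases hi.lt_or_eq with hi | rfl
    · exact (hM i hi i le_rfl).1
    · exact hlt
  have h := sq_sub_le_sum_bet ha hb he hp e hM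
  rw [hg]
  have h2 : f (stopAt (merge a b M) e) ^ 2 ≤ B ^ 2 := by
    rw [← sq_abs]
    exact pow_le_pow_left₀ (abs_nonneg _) ((hc _).le.trans hcB) 2
  have h3 := mul_le_mul_of_nonneg_left h2 (sq_nonneg δ)
  have h4 : l ^ 2 ≤ qvDiff a b f (stopAt (merge a b M) e) ^ 2 := by
    rw [← sq_abs (qvDiff _ _ _ _)]
    exact pow_le_pow_left₀ hl.le hDM 2
  linarith

end Gain

/-! ### Bounding a price path up to the time at which the strategy stops -/

theorem nhdsLT_neBot {T : ℝ} {u : Time T} (hu : 0 < (u : ℝ)) : (𝓝[<] u).NeBot := by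
  refine nhdsLT_neBot_of_exists_lt ⟨⟨0, le_rfl, hu.le.trans u.2.2⟩, ?_⟩
  exact Subtype.coe_lt_coe.1 hu

/-- The left limit at `u` inherits the bound `x`, and monotonicity of `ψ` turns the jump bound into
`ψ x`. -/
theorem PricePath.abs_le_of_lt {T : ℝ} {ψ : ℝ → ℝ} (hψ : MonotoneOn ψ (Set.Ici 0))
    (ω : PricePath T ψ) {u : Time T} (hu : 0 < (u : ℝ)) {x : ℝ} (hx : ∀ s < u, |ω s| ≤ x) :
    |ω u| ≤ x + ψ x := by
  have := nhdsLT_neBot hu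
  obtain ⟨l, hl⟩ := (ω.cadlag u).2
  have hx0 : 0 ≤ x := (abs_nonneg _).trans
    (hx ⟨0, le_rfl, hu.le.trans u.2.2⟩ (Subtype.coe_lt_coe.1 hu))
  have hleft : Function.leftLim ω.toFun u = l := leftLim_eq_of_tendsto hl
  have hlx : |l| ≤ x := le_of_tendsto hl.abs (by
    filter_upwards [self_mem_nhdsWithin] with s hs using hx s hs)
  have hj := ω.jump_le u hu
  have hsup : (⨆ s : Set.Iio u, |ω s|) ≤ x := Real.iSup_le (fun s => hx s s.2) hx0
  have hsup0 : 0 ≤ ⨆ s : Set.Iio u, |ω s| := Real.iSup_nonneg fun s => abs_nonneg _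
  have hj' := hj.trans (hψ hsup0 hx0 hsup)
  rw [jump, hleft] at hj'
  calc |ω u| = |l + (ω u - l)| := by congr 1; ring
    _ ≤ |l| + |ω u - l| := abs_add_le _ _
    _ ≤ x + ψ x := add_le_add hlx hj'

/-- The strategy may stop by a jump beyond `c`. Before the stopping time the path is within `ε` of a
merged-time value below `c`, so the overshoot is at most `ε + ψ (c + ε)`. -/
theorem PricePath.abs_stopAt_merge_le {T : ℝ} {ψ : ℝ → ℝ} (hψ : MonotoneOn ψ (Set.Ici 0))
    (hψ_pos : ∀ u : ℝ, 0 ≤ u → 0 < ψ u)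
    {a b : ℕ → WithTop (Time T)} (ha : IsPartition a) (hb : IsPartition b) {ε c : ℝ} (hε : 0 ≤ ε)
    (ω : PricePath T ψ) (hfa : IsFine a ω ε) {e : Time T} (he : ∀ t, t ≤ e) (M : ℕ)
    (hM : ∀ j ≤ M, |ω (stopAt (merge a b j) e)| < c) (t : Time T) :
    |ω (stopAt (merge a b (M + 1)) t)| ≤ c + ε + ψ (c + ε) := by
  have hmono := merge_monotone ha.monotone hb.monotone
  have hx0 : 0 ≤ c + ε := add_nonneg ((abs_nonneg _).trans (hM 0 (Nat.zero_le M)).le) hε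
  have hlt : ∀ s : Time T, (s : WithTop (Time T)) < merge a b (M + 1) → |ω s| ≤ c + ε := by
    intro s hs
    obtain ⟨j, h1, h2⟩ := exists_merge_index ha hb s
    have hj : j ≤ M := Nat.lt_succ_iff.1 (hmono.reflect_lt (h1.trans_lt hs))
    have hte : stopAt (merge a b j) e = stopAt (merge a b j) s := by
      rw [← WithTop.coe_inj, coe_stopAt_of_ge h1,
        coe_stopAt_of_ge (h1.trans (WithTop.coe_le_coe.2 (he s)))]
    have h3 := abs_sub_le_of_merge ha hε hfa h1 h2
    have h4 := hM j hj
    rw [hte] at h4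
    calc |ω s| = |ω (stopAt (merge a b j) s) + (ω s - ω (stopAt (merge a b j) s))| := by
          congr 1; ring
      _ ≤ c + ε := (abs_add_le _ _).trans (add_le_add h4.le h3)
  rcases lt_or_ge (t : WithTop (Time T)) (merge a b (M + 1)) with h | h
  · rw [stopAt_of_le h.le]
    exact (hlt t h).trans (le_add_of_nonneg_right (hψ_pos _ hx0).le)
  · have hu := coe_stopAt_of_ge h
    set u := stopAt (merge a b (M + 1)) t
    -- At time `0` there is no left limit, but that time is the merged time of index `0`.
    rcases u.2.1.eq_or_lt with h0 | h0
    · have hu0 : u = stopAt (merge a b 0) e :=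
        Subtype.ext (h0.symm.trans (coe_stopAt_merge_zero ha hb e).symm)
      rw [hu0]
      have := hψ_pos _ hx0
      linarith [hM 0 (Nat.zero_le M)]
    · exact ω.abs_le_of_lt hψ h0 fun s hs => hlt s (hu ▸ WithTop.coe_lt_coe.2 hs)

/-! ### Measurability -/

/-- Rounding a time up to the next multiple of `1 / (n + 1)`, but to at most `t`. -/
noncomputable def roundUp {T : ℝ} (t : Time T) (n k : ℕ) : Time T :=
  ⟨min t ((k + 1 : ℝ) / (n + 1)), le_min t.2.1 (by positivity), (min_le_left _ _).trans t.2.2⟩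

theorem roundUp_le {T : ℝ} (t : Time T) (n k : ℕ) : roundUp t n k ≤ t :=
  Subtype.coe_le_coe.1 (min_le_left _ _)

theorem tendsto_roundUp {T : ℝ} {u t : Time T} (hu : u ≤ t) :
    Tendsto (fun n : ℕ => roundUp t n ⌊(u : ℝ) * (n + 1)⌋₊) atTop (𝓝[≥] u) := by
  have hge : ∀ n : ℕ, u ≤ roundUp t n ⌊(u : ℝ) * (n + 1)⌋₊ := fun n => by
    have hn : (0 : ℝ) < n + 1 := by positivity
    refine Subtype.coe_le_coe.1 (le_min (Subtype.coe_le_coe.2 hu) ?_)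
    rw [le_div_iff₀ hn]
    exact (Nat.lt_floor_add_one _).le
  refine tendsto_nhdsWithin_iff.2 ⟨?_, Eventually.of_forall hge⟩
  rw [tendsto_subtype_rng]
  have hlim : Tendsto (fun n : ℕ => (u : ℝ) + 1 / ((n : ℝ) + 1)) atTop (𝓝 (u : ℝ)) := by
    simpa using tendsto_const_nhds.add (tendsto_one_div_add_atTop_nhds_zero_nat (𝕜 := ℝ))
  refine tendsto_of_tendsto_of_tendsto_of_le_of_le tendsto_const_nhds hlim
    (fun n => Subtype.coe_le_coe.2 (hge n)) fun n => ?_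
  have hn : (0 : ℝ) < n + 1 := by positivity
  refine (min_le_right _ _).trans ?_
  rw [div_le_iff₀ hn, add_mul, one_div_mul_cancel hn.ne']
  have := Nat.floor_le (mul_nonneg u.2.1 hn.le)
  linarith

/-- By right-continuity the value at a random time is the limit of values at countably valued times
above it. Capping these at `t` keeps all evaluations within what is known at `t`. -/
theorem measurable_eval_of_le {T : ℝ} {ψ : ℝ → ℝ} [MeasurableSpace (PricePath T ψ)] {t : Time T}
    (hm : ∀ s ≤ t, Measurable fun ω : PricePath T ψ => ω s) {g : PricePath T ψ → Time T}
    (hg : Measurable g) (hgt : ∀ ω, g ω ≤ t) : Measurable fun ω : PricePath T ψ => ω (g ω) := by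
  refine measurable_of_tendsto_metrizable
    (f := fun n ω => ω (roundUp t n ⌊(g ω : ℝ) * (n + 1)⌋₊)) (fun n => ?_) ?_
  · have h1 : Measurable fun p : PricePath T ψ × ℕ => p.1 (roundUp t n p.2) :=
      measurable_from_prod_countable_left fun k => hm _ (roundUp_le t n k)
    have h2 : Measurable fun ω => ⌊(g ω : ℝ) * (n + 1)⌋₊ :=
      Nat.measurable_floor.comp ((measurable_subtype_coe.comp hg).mul_const _)
    exact h1.comp (measurable_id.prodMk h2)
  · rw [tendsto_pi_nhds]
    exact fun ω => ((ω.cadlag (g ω)).1.tendsto).comp (tendsto_roundUp (hgt ω))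

theorem le_universalCompletion {Ω : Type*} (m : MeasurableSpace Ω) : m ≤ universalCompletion m :=
  fun _ hs _ _ => MeasurableSet.nullMeasurableSet hs

theorem measurable_eval {T : ℝ} {ψ : ℝ → ℝ} {s t : Time T} (h : s ≤ t) :
    Measurable[pathFiltration T ψ t] fun ω : PricePath T ψ => ω s := by
  have h1 : MeasurableSpace.comap (fun ω : PricePath T ψ => ω s) (borel ℝ) ≤
      pathFiltration T ψ t :=
    (le_iSup (fun s : Set.Iic t => MeasurableSpace.comap
      (fun ω : PricePath T ψ => ω s) (borel ℝ)) ⟨s, h⟩).trans (le_universalCompletion _)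
  rw [measurable_iff_comap_le, BorelSpace.measurable_eq (α := ℝ)]
  exact h1

section Stopping

variable {T : ℝ} {ψ : ℝ → ℝ} {τ σ : PricePath T ψ → WithTop (Time T)}

theorem measurable_stopAt (hτ : IsStoppingTime (pathFiltration T ψ) τ) (t : Time T) :
    Measurable[pathFiltration T ψ t] fun ω => stopAt (τ ω) t := by
  let _ : MeasurableSpace (PricePath T ψ) := pathFiltration T ψ t
  refine measurable_of_Iic fun s => ?_
  rcases le_or_gt t s with h | h
  · convert! MeasurableSet.univ using 1
    refine eq_univ_of_forall fun ω => (show stopAt (τ ω) t ≤ s from ?_)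
    exact (min_le_right _ _).trans h
  · have : (fun ω => stopAt (τ ω) t) ⁻¹' Set.Iic s = {ω | τ ω ≤ s} := by
      ext ω
      change stopAt (τ ω) t ≤ s ↔ τ ω ≤ s
      rw [← WithTop.coe_le_coe, coe_stopAt, min_le_iff, WithTop.coe_le_coe,
        or_iff_left (not_le.2 h)]
    rw [this]
    exact (pathFiltration T ψ).mono h.le _ (hτ s)

theorem measurable_eval_stopAt_fixed (hτ : IsStoppingTime (pathFiltration T ψ) τ) (t : Time T) :
    Measurable[pathFiltration T ψ t] fun ω : PricePath T ψ => ω (stopAt (τ ω) t) := by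
  let _ : MeasurableSpace (PricePath T ψ) := pathFiltration T ψ t
  exact measurable_eval_of_le (t := t) (fun s hs => measurable_eval hs) (measurable_stopAt hτ t)
    fun ω => min_le_right _ _

theorem measurable_eval_stopAt (hτ : IsStoppingTime (pathFiltration T ψ) τ) {e : Time T}
    (he : ∀ t, t ≤ e) :
    Measurable[hτ.measurableSpace] fun ω : PricePath T ψ => ω (stopAt (τ ω) e) := by
  intro B hB
  rw [hτ.measurableSet]
  refine ⟨(le_iSup (fun t => (pathFiltration T ψ t)) e) _
    (measurable_eval_stopAt_fixed hτ e hB), fun t => ?_⟩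
  -- Where `τ ≤ t`, stopping at `e` or at `t` gives the same time, so information up to `t`
  -- suffices.
  have h : (fun ω : PricePath T ψ => ω (stopAt (τ ω) e)) ⁻¹' B ∩ {ω | τ ω ≤ t} =
      (fun ω : PricePath T ψ => ω (stopAt (τ ω) t)) ⁻¹' B ∩ {ω | τ ω ≤ t} := by
    ext ω
    refine and_congr_left fun hω => ?_
    have hω' : τ ω ≤ t := hω
    have hte : stopAt (τ ω) e = stopAt (τ ω) t := by
      rw [← WithTop.coe_inj, coe_stopAt_of_ge hω',
        coe_stopAt_of_ge (hω'.trans (WithTop.coe_le_coe.2 (he t)))]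
    simp only [Set.mem_preimage, hte]
  rw [h]
  exact (measurable_eval_stopAt_fixed hτ t hB).inter (hτ t)

theorem measurable_eval_stopAt_of_le (hσ : IsStoppingTime (pathFiltration T ψ) σ)
    (hτ : IsStoppingTime (pathFiltration T ψ) τ) (h : ∀ ω, σ ω ≤ τ ω) {e : Time T}
    (he : ∀ t, t ≤ e) :
    Measurable[hτ.measurableSpace] fun ω : PricePath T ψ => ω (stopAt (σ ω) e) :=
  (measurable_eval_stopAt hσ he).mono (hσ.measurableSpace_mono hτ h) le_rfl

theorem measurable_tsum_of_finite {Ω : Type*} [MeasurableSpace Ω] {F : ℕ → Ω → ℝ}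
    (hF : ∀ k, Measurable (F k)) (hfin : ∀ ω, ∃ N, ∀ k, N ≤ k → F k ω = 0) :
    Measurable fun ω => ∑' k, F k ω := by
  refine measurable_of_tendsto_metrizable (f := fun n ω => ∑ k ∈ Finset.range n, F k ω)
    (fun n => Finset.measurable_fun_sum _ fun k _ => hF k) ?_
  rw [tendsto_pi_nhds]
  intro ω
  obtain ⟨N, hN⟩ := hfin ω
  exact (summable_of_ne_finset_zero (s := Finset.range N)
    fun k hk => hN k (by simpa using hk)).hasSum.tendsto_sum_nat

variable {a b : ℕ → PricePath T ψ → WithTop (Time T)}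

theorem measurable_qvApprox_stopAt (ha : ∀ k, IsStoppingTime (pathFiltration T ψ) (a k))
    (hpa : ∀ ω, IsPartition fun k => a k ω) (hτ : IsStoppingTime (pathFiltration T ψ) τ)
    {e : Time T} (he : ∀ t, t ≤ e) :
    Measurable[hτ.measurableSpace] fun ω : PricePath T ψ =>
      qvApprox (fun k => a k ω) ω (stopAt (τ ω) e) := by
  let _ : MeasurableSpace (PricePath T ψ) := hτ.measurableSpace
  have h : ∀ k, Measurable fun ω : PricePath T ψ => ω (stopAt (a k ω) (stopAt (τ ω) e)) := by
    intro k
    simp_rw [stopAt_stopAt]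
    exact measurable_eval_stopAt_of_le ((ha k).min hτ) hτ (fun ω => min_le_right _ _) he
  refine measurable_tsum_of_finite (fun k => ((h (k + 1)).sub (h k)).pow_const 2) fun ω => ?_
  obtain ⟨N, hN⟩ := (hpa ω).exists_top
  refine ⟨N, fun k hk => ?_⟩
  simp [hN k hk, hN (k + 1) (by omega)]

theorem measurable_lastValue (ha : ∀ k, IsStoppingTime (pathFiltration T ψ) (a k))
    (hpa : ∀ ω, IsPartition fun k => a k ω) (hτ : IsStoppingTime (pathFiltration T ψ) τ)
    {e : Time T} (he : ∀ t, t ≤ e) :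
    Measurable[hτ.measurableSpace] fun ω : PricePath T ψ =>
      lastValue (fun k => a k ω) ω e (τ ω) := by
  let _ : MeasurableSpace (PricePath T ψ) := hτ.measurableSpace
  refine measurable_tsum_of_finite (fun k => ?_) fun ω => ?_
  · refine Measurable.ite ?_
      (measurable_eval_stopAt_of_le ((ha k).min hτ) hτ (fun ω => min_le_right _ _) he)
      measurable_const
    refine ((ha k).measurableSet_stopping_time_le hτ).inter ?_
    have h : {ω | τ ω < a (k + 1) ω} = {ω | a (k + 1) ω ≤ τ ω}ᶜ := by
      ext ω
      simp
    have h' : MeasurableSet {ω | τ ω < a (k + 1) ω} := by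
      rw [h]
      exact ((ha (k + 1)).measurableSet_stopping_time_le hτ).compl
    exact h'
  · obtain ⟨N, hN⟩ := (hpa ω).exists_top
    refine ⟨N, fun k hk => if_neg fun h => ?_⟩
    have h1 : a k ω ≤ τ ω := h.1
    rw [hN k hk, top_le_iff] at h1
    exact absurd h.2 (by rw [h1]; exact not_top_lt)

/-- The min-max form of `merge` has no random indices, which reduces the claim to finite unions of
events about maxima of stopping times. -/
theorem isStoppingTime_merge (ha : ∀ k, IsStoppingTime (pathFiltration T ψ) (a k))
    (hb : ∀ k, IsStoppingTime (pathFiltration T ψ) (b k)) (j : ℕ) :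
    IsStoppingTime (pathFiltration T ψ) fun ω => merge (fun k => a k ω) (fun k => b k ω) j := by
  intro t
  have h : {ω | merge (fun k => a k ω) (fun k => b k ω) j ≤ t} =
      ⋃ i ∈ Finset.range (j + 1), {ω | max (a i ω) (b (j - i) ω) ≤ t} := by
    ext ω
    simp only [Set.mem_iUnion, Finset.mem_range, exists_prop]
    constructor
    · intro hω
      obtain ⟨i, hi, h⟩ := exists_merge_eq (fun k => a k ω) (fun k => b k ω) j
      exact ⟨i, by omega, h.symm.le.trans hω⟩
    · rintro ⟨i, hi, hω⟩
      exact (merge_le (a := fun k => a k ω) (b := fun k => b k ω) (by omega : i ≤ j)).trans hω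
  rw [h]
  exact Finset.measurableSet_biUnion _ fun i _ => ((ha i).max (hb (j - i))) t

theorem measurable_bet (ha : ∀ k, IsStoppingTime (pathFiltration T ψ) (a k))
    (hb : ∀ k, IsStoppingTime (pathFiltration T ψ) (b k))
    (hpa : ∀ ω, IsPartition fun k => a k ω) (hpb : ∀ ω, IsPartition fun k => b k ω)
    {e : Time T} (he : ∀ t, t ≤ e) (δ l c : ℝ) (j : ℕ) :
    Measurable[(isStoppingTime_merge ha hb j).measurableSpace] fun ω : PricePath T ψ =>
      bet (fun k => a k ω) (fun k => b k ω) ω e δ l c j := by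
  have hmerge := isStoppingTime_merge ha hb
  have hle : ∀ i ≤ j, ∀ ω, merge (fun k => a k ω) (fun k => b k ω) i ≤
      merge (fun k => a k ω) (fun k => b k ω) j :=
    fun i hi ω => merge_monotone (hpa ω).monotone (hpb ω).monotone hi
  have hD : ∀ i ≤ j, Measurable[(hmerge j).measurableSpace] fun ω : PricePath T ψ =>
      qvDiff (fun k => a k ω) (fun k => b k ω) ω
        (stopAt (merge (fun k => a k ω) (fun k => b k ω) i) e) := fun i hi => by
    have h1 := (measurable_qvApprox_stopAt ha hpa (hmerge i) he).mono
      ((hmerge i).measurableSpace_mono (hmerge j) (hle i hi)) le_rfl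
    have h2 := (measurable_qvApprox_stopAt hb hpb (hmerge i) he).mono
      ((hmerge i).measurableSpace_mono (hmerge j) (hle i hi)) le_rfl
    exact h1.sub h2
  have hV : ∀ i ≤ j, Measurable[(hmerge j).measurableSpace] fun ω : PricePath T ψ =>
      ω (stopAt (merge (fun k => a k ω) (fun k => b k ω) i) e) := fun i hi =>
    measurable_eval_stopAt_of_le (hmerge i) (hmerge j) (hle i hi) he
  have hA := measurable_lastValue ha hpa (hmerge j) he
  have hB := measurable_lastValue hb hpb (hmerge j) he
  let _ : MeasurableSpace (PricePath T ψ) := (hmerge j).measurableSpace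
  refine Measurable.ite ?_ ?_ measurable_const
  · have h : {ω : PricePath T ψ | Active (fun k => a k ω) (fun k => b k ω) ω e l c j} =
        ⋂ i ∈ Finset.range (j + 1), {ω : PricePath T ψ |
          |qvDiff (fun k => a k ω) (fun k => b k ω) ω
            (stopAt (merge (fun k => a k ω) (fun k => b k ω) i) e)| < l ∧
          |ω (stopAt (merge (fun k => a k ω) (fun k => b k ω) i) e)| < c} := by
      ext ω
      simp [Active]
    rw [h]
    refine Finset.measurableSet_biInter _ fun i hi => ?_
    have hi' : i ≤ j := by simpa [Nat.lt_succ_iff] using hi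
    exact (measurableSet_lt (hD i hi').abs measurable_const).inter
      (measurableSet_lt (hV i hi').abs measurable_const)
  · exact (((hD j le_rfl).const_mul 2).mul ((hB.sub hA).const_mul 2)).sub
      ((hV j le_rfl).const_mul _)

end Stopping

/-! ### The betting strategy -/

/-- The strategy with positions `s * bet` at the times of the merged partition. -/
noncomputable def betStrategy {T : ℝ} {ψ : ℝ → ℝ} {a b : ℕ → PricePath T ψ → WithTop (Time T)}
    (ha : ∀ k, IsStoppingTime (pathFiltration T ψ) (a k))
    (hb : ∀ k, IsStoppingTime (pathFiltration T ψ) (b k))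
    (hpa : ∀ ω, IsPartition fun k => a k ω) (hpb : ∀ ω, IsPartition fun k => b k ω)
    {e : Time T} (he : ∀ t, t ≤ e) {δ l c : ℝ} (hl : 0 ≤ l) (hc : 0 ≤ c) (hδ : 0 ≤ δ)
    (hp : ∀ ω τ, |qvPosition (fun k => a k ω) (fun k => b k ω) (ω : PricePath T ψ) e τ| ≤ δ)
    (s : ℝ) : SimpleStrategy T ψ where
  τ j ω := merge (fun k => a k ω) (fun k => b k ω) j
  isStoppingTime := isStoppingTime_merge ha hb
  mono j ω := merge_monotone (hpa ω).monotone (hpb ω).monotone (Nat.le_succ j)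
  finite ω := by
    obtain ⟨N, hN⟩ := exists_merge_eq_top (hpa ω) (hpb ω)
    refine (Set.finite_lt_nat N).subset fun j hj => ?_
    by_contra h
    exact hj (hN j (not_lt.1 h))
  h j ω := s * bet (fun k => a k ω) (fun k => b k ω) ω e δ l c j
  bounded j := ⟨|s| * (2 * l * δ + 2 * δ ^ 2 * c), fun ω => by
    rw [abs_mul]
    exact mul_le_mul_of_nonneg_left (abs_bet_le hl hc hδ (hp ω) j) (abs_nonneg s)⟩
  measurable j := (measurable_bet ha hb hpa hpb he δ l c j).const_mul s

theorem betStrategy_capital {T : ℝ} {ψ : ℝ → ℝ} {a b : ℕ → PricePath T ψ → WithTop (Time T)}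
    (ha : ∀ k, IsStoppingTime (pathFiltration T ψ) (a k))
    (hb : ∀ k, IsStoppingTime (pathFiltration T ψ) (b k))
    (hpa : ∀ ω, IsPartition fun k => a k ω) (hpb : ∀ ω, IsPartition fun k => b k ω)
    {e : Time T} (he : ∀ t, t ≤ e) {δ l c : ℝ} (hl : 0 ≤ l) (hc : 0 ≤ c) (hδ : 0 ≤ δ)
    (hp : ∀ ω τ, |qvPosition (fun k => a k ω) (fun k => b k ω) (ω : PricePath T ψ) e τ| ≤ δ)
    (s x : ℝ) (t : Time T) (ω : PricePath T ψ) :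
    (betStrategy ha hb hpa hpb he hl hc hδ hp s).capital (s * x) t ω =
      s * (x + gain (fun k => a k ω) (fun k => b k ω) ω e δ l c t) := by
  rw [mul_add, gain, ← tsum_mul_left]
  simp only [SimpleStrategy.capital, betStrategy, mul_assoc]

/-- Two partitions that are fine at scale `ε` give approximations to the quadratic variation
which differ by a given amount only at a price quadratic in `ε`. -/
theorem exists_strategy_of_isFine {T : ℝ} {ψ : ℝ → ℝ} (hψ : MonotoneOn ψ (Set.Ici 0))
    (hψ_pos : ∀ u : ℝ, 0 ≤ u → 0 < ψ u)
    {a b : ℕ → PricePath T ψ → WithTop (Time T)}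
    (ha : ∀ k, IsStoppingTime (pathFiltration T ψ) (a k))
    (hb : ∀ k, IsStoppingTime (pathFiltration T ψ) (b k))
    (hpa : ∀ ω, IsPartition fun k => a k ω) (hpb : ∀ ω, IsPartition fun k => b k ω)
    {ε l c B : ℝ} (hε : 0 ≤ ε) (hfa : ∀ ω : PricePath T ψ, IsFine (fun k => a k ω) ω ε)
    (hfb : ∀ ω : PricePath T ψ, IsFine (fun k => b k ω) ω ε) (hl : 0 < l) (hc : 0 ≤ c)
    (hB : c + ε + ψ (c + ε) ≤ B) {e : Time T} (he : ∀ t, t ≤ e) :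
    ∃ G : SimpleStrategy T ψ,
      (∀ t ω, 0 ≤ G.capital ((4 * ε) ^ 2 * B ^ 2 / l ^ 2) t ω) ∧
      ∀ ω : PricePath T ψ, (∀ t, |ω t| < c) →
        (∃ t, l + 4 * ε * ε ≤ |qvDiff (fun k => a k ω) (fun k => b k ω) ω t|) →
        1 ≤ G.capital ((4 * ε) ^ 2 * B ^ 2 / l ^ 2) e ω := by
  have hp : ∀ (ω : PricePath T ψ) τ,
      |qvPosition (fun k => a k ω) (fun k => b k ω) ω e τ| ≤ 4 * ε :=
    fun ω => abs_qvPosition_le (hpa ω) (hpb ω) hε (hfa ω) (hfb ω) he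
  have hψc := hψ_pos (c + ε) (add_nonneg hc hε)
  refine ⟨betStrategy ha hb hpa hpb he hl.le hc (by positivity) hp (l ^ 2)⁻¹, fun t ω => ?_,
    fun ω hω hbig => ?_⟩
  · rw [div_eq_inv_mul, betStrategy_capital]
    exact mul_nonneg (by positivity) (gain_nonneg (hpa ω) (hpb ω) he (hp ω)
      (fun M hM t => (ω.abs_stopAt_merge_le hψ hψ_pos (hpa ω) (hpb ω) hε (hfa ω) he M hM t).trans
        hB) t)
  · rw [div_eq_inv_mul, betStrategy_capital, ← div_eq_inv_mul, one_le_div (by positivity)]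
    exact le_gain (hpa ω) (hpb ω) hε hl (hfa ω) he (hp ω) (by linarith) hω hbig

/-! ### Null sets -/

section Null

variable {T : ℝ} {ψ : ℝ → ℝ}

theorem isNull_iff {E : Set (PricePath T ψ)} :
    IsNull E ↔ ∀ x : ℝ, 0 < x → ∃ S : NonnegCapital T ψ,
      (∀ (ω : PricePath T ψ) (t : Time T), (t : ℝ) = T → E.indicator 1 ω ≤ S.value t ω) ∧
        ∑' n, S.α n < x := by
  refine (show IsNull E ↔ _ = ⊥ from Iff.rfl).trans (sInf_eq_bot.trans ?_)
  constructor
  · intro h x hx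
    obtain ⟨y, ⟨S, hS, rfl⟩, hy⟩ := h (ENNReal.ofReal x) (by simpa using hx)
    exact ⟨S, hS, (ENNReal.ofReal_lt_ofReal_iff hx).1 hy⟩
  · intro h y hy
    obtain ⟨x, hx0, hxy⟩ := ENNReal.lt_iff_exists_real_btwn.1 hy
    have hx : 0 < x := ENNReal.ofReal_pos.1 hxy.1
    obtain ⟨S, hS, hSx⟩ := h x hx
    exact ⟨_, ⟨S, hS, rfl⟩, ((ENNReal.ofReal_lt_ofReal_iff hx).2 hSx).trans hxy.2⟩

theorem IsNull.mono {E F : Set (PricePath T ψ)} (hF : IsNull F) (h : E ⊆ F) : IsNull E := by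
  rw [isNull_iff] at hF ⊢
  intro x hx
  obtain ⟨S, hS, hSx⟩ := hF x hx
  exact ⟨S, fun ω t ht =>
    (Set.indicator_le_indicator_of_subset h (fun _ => zero_le) ω).trans (hS ω t ht), hSx⟩

theorem SimpleStrategy.capital_zero (G : SimpleStrategy T ψ) (x : ℝ) {z : Time T}
    (hz : (z : ℝ) = 0) (ω : PricePath T ψ) : G.capital x z ω = x := by
  have h : ∀ τ, stopAt τ z = z := fun τ => le_antisymm (min_le_right _ _)
    (Subtype.coe_le_coe.1 (hz.le.trans (stopAt τ z).2.1))
  simp [SimpleStrategy.capital, h]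

theorem NonnegCapital.α_nonneg [Nonempty (PricePath T ψ)] (hT : 0 ≤ T) (S : NonnegCapital T ψ)
    (n : ℕ) : 0 ≤ S.α n := by
  obtain ⟨ω⟩ := ‹Nonempty (PricePath T ψ)›
  have h := S.nonneg n ⟨0, le_rfl, hT⟩ ω
  rwa [SimpleStrategy.capital_zero _ _ rfl] at h

theorem isNull_iUnion (hT : 0 ≤ T) {E : ℕ → Set (PricePath T ψ)} (h : ∀ n, IsNull (E n)) :
    IsNull (⋃ n, E n) := by
  -- The initial capitals are seen to be nonnegative by evaluating the capital at time `0` on some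
  -- path.
  rcases isEmpty_or_nonempty (PricePath T ψ) with hΩ | hΩ
  · exact (h 0).mono fun ω => isEmptyElim ω
  rw [isNull_iff]
  intro x hx
  -- These budgets sum to `x / 2`, which leaves the total strictly below `x`.
  choose S hS hSx using fun n => isNull_iff.1 (h n) (x / 2 / 2 / 2 ^ n) (by positivity)
  have hα : ∀ n k, 0 ≤ (S n).α k := fun n => (S n).α_nonneg hT
  set A : ℕ × ℕ → ℝ := fun p => (S p.1).α p.2
  have hsum : Summable A := by
    refine (summable_prod_of_nonneg fun p => hα p.1 p.2).2 ⟨fun n => (S n).summable, ?_⟩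
    exact (summable_geometric_two' (x / 2)).of_nonneg_of_le (fun n => tsum_nonneg (hα n))
      fun n => (hSx n).le
  refine ⟨⟨fun m => (S (Nat.pairEquiv.symm m).1).G (Nat.pairEquiv.symm m).2,
    fun m => A (Nat.pairEquiv.symm m), fun m => (S _).nonneg _,
    (Nat.pairEquiv.symm.summable_iff (f := A)).2 hsum⟩, fun ω t ht => ?_, ?_⟩
  · by_cases hω : ω ∈ ⋃ n, E n
    · obtain ⟨n, hn⟩ := Set.mem_iUnion.1 hω
      have h1 := hS n ω t ht
      rw [Set.indicator_of_mem hn] at h1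
      rw [Set.indicator_of_mem hω]
      refine h1.trans ?_
      have h2 := Nat.pairEquiv.symm.tsum_eq fun p : ℕ × ℕ =>
        ENNReal.ofReal (((S p.1).G p.2).capital ((S p.1).α p.2) t ω)
      refine le_trans ?_ h2.symm.le
      rw [ENNReal.tsum_prod (f := fun n k =>
        ENNReal.ofReal (((S n).G k).capital ((S n).α k) t ω))]
      exact ENNReal.le_tsum (f := fun n => (S n).value t ω) n
    · rw [Set.indicator_of_notMem hω]
      exact zero_le
  · change ∑' m, A (Nat.pairEquiv.symm m) < x
    rw [Nat.pairEquiv.symm.tsum_eq A, hsum.tsum_prod]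
    calc ∑' n, ∑' k, A (n, k) ≤ ∑' n : ℕ, x / 2 / 2 / 2 ^ n :=
          Summable.tsum_le_tsum (fun n => (hSx n).le) hsum.prod (summable_geometric_two' _)
      _ = x / 2 := tsum_geometric_two' _
      _ < x := by linarith

/-- A Borel–Cantelli lemma for the upper price. -/
theorem isNull_frequently {E : ℕ → Set (PricePath T ψ)} (G : ℕ → SimpleStrategy T ψ) {α : ℕ → ℝ}
    (hα : Summable α) (hG : ∀ n t ω, 0 ≤ (G n).capital (α n) t ω)
    (hE : ∀ n, ∀ ω ∈ E n, ∀ t : Time T, (t : ℝ) = T → 1 ≤ (G n).capital (α n) t ω) :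
    IsNull {ω | ∃ᶠ n in atTop, ω ∈ E n} := by
  rw [isNull_iff]
  intro x hx
  obtain ⟨N, hN⟩ := ((tendsto_order.1 (tendsto_sum_nat_add α)).2 x hx).exists
  refine ⟨⟨fun n => G (n + N), fun n => α (n + N), fun n => hG (n + N),
    (summable_nat_add_iff N).2 hα⟩, fun ω t ht => ?_, hN⟩
  by_cases hω : ∃ᶠ n in atTop, ω ∈ E n
  · rw [Set.indicator_of_mem (show ω ∈ {ω | ∃ᶠ n in atTop, ω ∈ E n} from hω)]
    obtain ⟨n, hn, hnE⟩ := (frequently_atTop.1 hω) N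
    obtain ⟨k, rfl⟩ := Nat.exists_eq_add_of_le' hn
    refine le_trans ?_ (ENNReal.le_tsum k)
    exact ENNReal.one_le_ofReal.2 (hE _ ω hnE t ht)
  · rw [Set.indicator_of_notMem (show ω ∉ {ω | ∃ᶠ n in atTop, ω ∈ E n} from hω)]
    exact zero_le

end Null

/-! ### Boundedness -/

/-- Every value is within `ε` of one of finitely many values at partition points. A natural number
as bound allows localisation in `c` by a countable union. -/
theorem IsFine.exists_abs_lt {T : ℝ} {π : ℕ → WithTop (Time T)} {f : Time T → ℝ} {ε : ℝ}
    (h : IsFine π f ε) (hε : 0 ≤ ε) (hπ : IsPartition π) : ∃ c : ℕ, ∀ t, |f t| < c := by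
  rcases isEmpty_or_nonempty (Time T) with hT | ⟨⟨t₀⟩⟩
  · exact ⟨0, fun t => isEmptyElim t⟩
  have hT : (0 : ℝ) ≤ T := t₀.2.1.trans t₀.2.2
  set e : Time T := ⟨T, hT, le_rfl⟩
  obtain ⟨N, hN⟩ := hπ.exists_top
  obtain ⟨c, hc⟩ := exists_nat_gt (∑ k ∈ Finset.range N, |f (stopAt (π k) e)| + ε)
  refine ⟨c, fun t => lt_of_le_of_lt ?_ hc⟩
  obtain ⟨k, h1, h2⟩ := hπ.exists_index t
  have hk : k < N := by
    by_contra hk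
    rw [hN k (not_lt.1 hk)] at h1
    exact absurd h1 (by simp)
  have hte : stopAt (π k) e = stopAt (π k) t := by
    rw [← WithTop.coe_inj, coe_stopAt_of_ge h1,
      coe_stopAt_of_ge (h1.trans (WithTop.coe_le_coe.2 (Subtype.coe_le_coe.1 t.2.2)))]
  have h3 : |f (stopAt (π k) e)| ≤ ∑ k ∈ Finset.range N, |f (stopAt (π k) e)| :=
    Finset.single_le_sum (f := fun k => |f (stopAt (π k) e)|) (fun _ _ => abs_nonneg _)
      (Finset.mem_range.2 hk)
  have h4 : |f t - f (stopAt (π k) e)| ≤ ε := by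
    rw [hte]
    refine h.abs_sub_le hε (min_le_right _ _) fun j hj => ?_
    rw [coe_stopAt_of_ge h1] at hj
    exact absurd (hj.2.trans_lt h2) (not_lt.2 (hπ.monotone (hπ.monotone.reflect_lt hj.1)))
  calc |f t| = |f (stopAt (π k) e) + (f t - f (stopAt (π k) e))| := by congr 1; ring
    _ ≤ _ := (abs_add_le _ _).trans (add_le_add h3 h4)

theorem exists_qvApprox_le {T : ℝ} {π : ℕ → WithTop (Time T)} {f : Time T → ℝ}
    (hπ : IsPartition π) {c : ℝ} (hc : ∀ t, |f t| < c) : ∃ K, ∀ t, |qvApprox π f t| ≤ K := by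
  obtain ⟨N, hN⟩ := hπ.exists_top
  refine ⟨∑ k ∈ Finset.range N, (2 * c) ^ 2, fun t => ?_⟩
  rw [qvApprox_eq_sum hN, abs_of_nonneg (Finset.sum_nonneg fun _ _ => sq_nonneg _)]
  refine Finset.sum_le_sum fun k _ => sq_le_sq' ?_ ?_ <;>
  linarith [abs_lt.1 (hc (stopAt (π (k + 1)) t)), abs_lt.1 (hc (stopAt (π k) t))]

/-- The approximations along two sequences of partitions of geometrically decreasing fineness
typically differ by a geometrically decreasing amount. -/
theorem isNull_frequently_qvDiff {T : ℝ} (hT : 0 < T) {ψ : ℝ → ℝ} (hψ : MonotoneOn ψ (Set.Ici 0))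
    (hψ_pos : ∀ u : ℝ, 0 ≤ u → 0 < ψ u)
    {a b : ℕ → ℕ → PricePath T ψ → WithTop (Time T)}
    (ha : ∀ n k, IsStoppingTime (pathFiltration T ψ) (a n k))
    (hb : ∀ n k, IsStoppingTime (pathFiltration T ψ) (b n k))
    (hpa : ∀ n ω, IsPartition fun k => a n k ω) (hpb : ∀ n ω, IsPartition fun k => b n k ω)
    {C : ℝ} (hC : 0 ≤ C)
    (hfa : ∀ n (ω : PricePath T ψ), IsFine (fun k => a n k ω) ω (C / 2 ^ n))
    (hfb : ∀ n (ω : PricePath T ψ), IsFine (fun k => b n k ω) ω (C / 2 ^ n)) :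
    IsNull {ω : PricePath T ψ | ∃ᶠ n : ℕ in atTop, ∃ t, (1 + 4 * C ^ 2) * (3 / 4) ^ n ≤
      |qvDiff (fun k => a n k ω) (fun k => b n k ω) ω t|} := by
  set e : Time T := ⟨T, hT.le, le_rfl⟩
  have he : ∀ t, t ≤ e := fun t => Subtype.coe_le_coe.1 t.2.2
  have hε : ∀ n : ℕ, 0 ≤ C / 2 ^ n ∧ C / 2 ^ n ≤ C := fun n =>
    ⟨by positivity, div_le_self hC (one_le_pow₀ one_le_two)⟩
  set bad : ℕ → ℕ → Set (PricePath T ψ) := fun c n => {ω | (∀ t, |ω t| < c) ∧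
    ∃ t, (3 / 4) ^ n + 4 * (C / 2 ^ n) * (C / 2 ^ n) ≤
      |qvDiff (fun k => a n k ω) (fun k => b n k ω) ω t|}
  have hbad : ∀ c : ℕ, IsNull {ω | ∃ᶠ n in atTop, ω ∈ bad c n} := by
    intro c
    have hc : (0 : ℝ) ≤ c := c.cast_nonneg
    -- The ratio `3/4` lies in `(1/2, 1)`: below `1` so that the differences decay, above `1/2` so
    -- that the costs are summable. `B` is independent of `n` because `C / 2 ^ n ≤ C`.
    choose G hG hG1 using fun n : ℕ => exists_strategy_of_isFine (l := (3 / 4) ^ n) (c := c)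
      (B := c + C + ψ (c + C)) hψ hψ_pos (ha n) (hb n) (hpa n) (hpb n) (hε n).1 (hfa n) (hfb n)
      (by positivity) hc
      (add_le_add (add_le_add_right (hε n).2 _) (hψ (add_nonneg hc (hε n).1) (add_nonneg hc hC)
        (add_le_add_right (hε n).2 _))) he
    refine isNull_frequently G ?_ hG fun n ω hω t ht => ?_
    · have h : ∀ n : ℕ, (4 * (C / 2 ^ n)) ^ 2 * (c + C + ψ (c + C)) ^ 2 / ((3 / 4 : ℝ) ^ n) ^ 2 =
          (4 * C) ^ 2 * (c + C + ψ (c + C)) ^ 2 * (4 / 9) ^ n := by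
        intro n
        have h1 : (4 / 9 : ℝ) ^ n = ((1 / 2 ^ n) / (3 / 4) ^ n) ^ 2 := by
          rw [← one_div_pow, ← div_pow, ← pow_mul, mul_comm n 2, pow_mul]
          norm_num
        rw [h1]
        ring
      simp_rw [h]
      exact (summable_geometric_of_lt_one (by norm_num) (by norm_num)).mul_left _
    · rw [show t = e from Subtype.ext ht]
      exact hG1 n ω hω.1 hω.2
  refine (isNull_iUnion hT.le hbad).mono fun ω hω => ?_
  obtain ⟨c, hc⟩ := (hfa 0 ω).exists_abs_lt (hε 0).1 (hpa 0 ω)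
  refine Set.mem_iUnion.2 ⟨c, Frequently.mono hω fun n ⟨t, ht⟩ => ⟨hc, t, le_trans ?_ ht⟩⟩
  have h1 : (1 / 4 : ℝ) ^ n ≤ (3 / 4) ^ n := pow_le_pow_left₀ (by norm_num) (by norm_num) n
  have h2 : 4 * (C / 2 ^ n) * (C / 2 ^ n) = 4 * C ^ 2 * (1 / 4) ^ n := by
    have : (1 / 4 : ℝ) ^ n = (1 / 2 ^ n) ^ 2 := by
      rw [← one_div_pow, ← pow_mul, mul_comm n 2, pow_mul]
      norm_num
    rw [this]
    ring
  rw [h2]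
  nlinarith [mul_le_mul_of_nonneg_left h1 (by positivity : 0 ≤ 4 * C ^ 2)]

/-- The finitely many exceptional `n` are absorbed into the constant by adding their `|K n| / r ^
n`. -/
theorem exists_forall_abs_le_geometric {ι : Type*} {F : ℕ → ι → ℝ} {r M : ℝ} (hr : 0 < r)
    (hM : 0 ≤ M) (h : ∀ᶠ n in atTop, ∀ t, |F n t| ≤ M * r ^ n) (hF : ∀ n, ∃ K, ∀ t, |F n t| ≤ K) :
    ∃ K, ∀ n t, |F n t| ≤ K * r ^ n := by
  obtain ⟨N, hN⟩ := eventually_atTop.1 h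
  choose K hK using hF
  have hnn : ∀ n, 0 ≤ |K n| / r ^ n := fun n => by positivity
  have hS : 0 ≤ ∑ n ∈ Finset.range N, |K n| / r ^ n := Finset.sum_nonneg fun n _ => hnn n
  refine ⟨M + ∑ n ∈ Finset.range N, |K n| / r ^ n, fun n t => ?_⟩
  have hrn : 0 < r ^ n := by positivity
  rcases le_or_gt N n with hn | hn
  · refine (hN n hn t).trans ?_
    gcongr
    linarith
  · rw [← div_le_iff₀ hrn]
    have h1 : |K n| / r ^ n ≤ ∑ n ∈ Finset.range N, |K n| / r ^ n :=
      Finset.single_le_sum (f := fun n => |K n| / r ^ n) (fun n _ => hnn n) (Finset.mem_range.2 hn)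
    have h2 : |F n t| / r ^ n ≤ |K n| / r ^ n := by
      exact div_le_div_of_nonneg_right ((hK n t).trans (le_abs_self _)) hrn.le
    linarith

/-! ### Càdlàg functions -/

section Cadlag

variable {T : ℝ} {f g : Time T → ℝ}

theorem IsCadlag.sub (hf : IsCadlag f) (hg : IsCadlag g) : IsCadlag fun t => f t - g t :=
  fun t => ⟨(hf t).1.sub (hg t).1, (hf t).2.choose - (hg t).2.choose,
    (hf t).2.choose_spec.sub (hg t).2.choose_spec⟩

theorem IsCadlag.pow (hf : IsCadlag f) (n : ℕ) : IsCadlag fun t => f t ^ n :=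
  fun t => ⟨(hf t).1.pow n, (hf t).2.choose ^ n, (hf t).2.choose_spec.pow n⟩

theorem IsCadlag.sum {ι : Type*} {F : ι → Time T → ℝ} (s : Finset ι) (hF : ∀ i, IsCadlag (F i)) :
    IsCadlag fun t => ∑ i ∈ s, F i t :=
  fun t => ⟨tendsto_finsetSum s fun i _ => (hF i t).1, ∑ i ∈ s, (hF i t).2.choose,
    tendsto_finsetSum s fun i _ => (hF i t).2.choose_spec⟩

theorem IsCadlag.comp_stopAt (hf : IsCadlag f) (τ : WithTop (Time T)) :
    IsCadlag fun t => f (stopAt τ t) := by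
  induction τ using WithTop.recTopCoe with
  | top => simpa only [stopAt_top] using hf
  | coe u =>
    have hs : ∀ t, stopAt (u : WithTop (Time T)) t = min u t := fun t => rfl
    intro t
    simp only [hs]
    refine ⟨?_, ?_⟩
    · refine ContinuousWithinAt.comp (t := Set.Ici (min u t)) (hf _).1
        (continuous_const.min continuous_id).continuousWithinAt fun s hs' => ?_
      exact min_le_min_left u hs'
    · rcases le_or_gt t u with h | h
      · obtain ⟨l, hl⟩ := (hf t).2
        refine ⟨l, hl.congr' ?_⟩
        filter_upwards [self_mem_nhdsWithin] with s hs'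
        rw [min_eq_right (le_of_lt (lt_of_lt_of_le hs' h))]
      · refine ⟨f u, tendsto_const_nhds.congr' ?_⟩
        filter_upwards [mem_nhdsWithin_of_mem_nhds (Ioi_mem_nhds h)] with s hs'
        rw [min_eq_left (le_of_lt hs')]

theorem isCadlag_qvApprox {π : ℕ → WithTop (Time T)} (hπ : IsPartition π) (hf : IsCadlag f) :
    IsCadlag (qvApprox π f) := by
  obtain ⟨N, hN⟩ := hπ.exists_top
  rw [funext (qvApprox_eq_sum (f := f) hN)]
  exact IsCadlag.sum _ fun k => ((hf.comp_stopAt _).sub (hf.comp_stopAt _)).pow 2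

theorem exists_tendsto_of_tendstoUniformly {X : Type*} {F : ℕ → X → ℝ} {A : X → ℝ} {p : Filter X}
    (h : TendstoUniformly F A atTop) (hF : ∀ n, ∃ l, Tendsto (F n) p (𝓝 l)) :
    ∃ l, Tendsto A p (𝓝 l) := by
  -- The trivial filter occurs: it is `𝓝[<] t` at time `0`.
  rcases p.eq_or_neBot with rfl | hp
  · exact ⟨0, tendsto_bot⟩
  refine cauchy_map_iff_exists_tendsto.1 (Metric.cauchy_iff.2 ⟨inferInstance, fun ε hε => ?_⟩)
  obtain ⟨n, hn⟩ := (Metric.tendstoUniformly_iff.1 h (ε / 4) (by positivity)).exists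
  obtain ⟨l, hl⟩ := hF n
  refine ⟨A '' {s | dist (F n s) l < ε / 4}, image_mem_map (Metric.tendsto_nhds.1 hl _
    (by positivity)), ?_⟩
  rintro _ ⟨s, hs, rfl⟩ _ ⟨s', hs', rfl⟩
  have h1 := hn s
  have h2 := hn s'
  simp only [Set.mem_ofPred_eq, Real.dist_eq, abs_lt] at *
  constructor <;> linarith

theorem IsCadlag.of_tendstoUniformly {F : ℕ → Time T → ℝ} (h : TendstoUniformly F f atTop)
    (hF : ∀ n, IsCadlag (F n)) : IsCadlag f := by
  refine fun t => ⟨?_, exists_tendsto_of_tendstoUniformly h fun n => (hF n t).2⟩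
  obtain ⟨l, hl⟩ := exists_tendsto_of_tendstoUniformly h fun n => ⟨_, (hF n t).1.tendsto⟩
  -- `𝓝[≥] t` contains the point `t` itself, so a limit along it must be `f t`.
  have hlt : f t = l := tendsto_nhds_unique (tendsto_pure_nhds f t)
    (hl.mono_left (pure_le_nhdsWithin (Set.mem_Ici.2 le_rfl)))
  rw [ContinuousWithinAt, hlt]
  exact hl

theorem exists_tendstoUniformly_of_geometric {X : Type*} {F : ℕ → X → ℝ} {r K : ℝ} (hr0 : 0 ≤ r)
    (hr : r < 1) (h : ∀ n t, |F (n + 1) t - F n t| ≤ K * r ^ n) :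
    ∃ A, TendstoUniformly F A atTop := by
  have hd : ∀ t n, dist (F n t) (F (n + 1) t) ≤ K * r ^ n := fun t n => by
    rw [dist_comm, Real.dist_eq]
    exact h n t
  choose A hA using fun t => cauchySeq_tendsto_of_complete
    (cauchySeq_of_le_geometric r K hr (hd t))
  refine ⟨A, Metric.tendstoUniformly_iff.2 fun ε hε => ?_⟩
  have hlim : Tendsto (fun n : ℕ => K * r ^ n / (1 - r)) atTop (𝓝 0) := by
    simpa using ((tendsto_pow_atTop_nhds_zero_of_lt_one hr0 hr).const_mul K).div_const (1 - r)
  filter_upwards [(tendsto_order.1 hlim).2 ε hε] with n hn t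
  rw [dist_comm]
  exact (dist_le_of_le_geometric_of_tendsto r K hr (hd t) (hA t) n).trans_lt hn

end Cadlag

/-! ### Arrays of dyadic type -/

theorem IsFine.mono {T : ℝ} {π : ℕ → WithTop (Time T)} {f : Time T → ℝ} {ε ε' : ℝ}
    (h : IsFine π f ε) (hε : ε ≤ ε') : IsFine π f ε' :=
  fun s t hst hlt => h s t hst (hε.trans_lt hlt)

/-- Off a null set, the approximations along two sequences of partitions of geometrically
decreasing fineness differ by a geometrically decreasing amount. -/
theorem exists_abs_qvDiff_le {T : ℝ} {ψ : ℝ → ℝ} {a b : ℕ → ℕ → PricePath T ψ → WithTop (Time T)}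
    (hpa : ∀ n ω, IsPartition fun k => a n k ω) (hpb : ∀ n ω, IsPartition fun k => b n k ω)
    {C : ℝ} (hC : 0 ≤ C)
    (hfa : ∀ n (ω : PricePath T ψ), IsFine (fun k => a n k ω) ω (C / 2 ^ n)) {ω : PricePath T ψ}
    (hω : ¬ ∃ᶠ n : ℕ in atTop, ∃ t, (1 + 4 * C ^ 2) * (3 / 4) ^ n ≤
      |qvDiff (fun k => a n k ω) (fun k => b n k ω) ω t|) :
    ∃ K : ℝ, ∀ (n : ℕ) (t : Time T),
      |qvDiff (fun k => a n k ω) (fun k => b n k ω) ω t| ≤ K * (3 / 4) ^ n := by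
  obtain ⟨c, hc⟩ := (hfa 0 ω).exists_abs_lt (by positivity) (hpa 0 ω)
  refine exists_forall_abs_le_geometric (M := 1 + 4 * C ^ 2) (by norm_num) (by positivity) ?_
    fun n => ?_
  · rw [not_frequently] at hω
    filter_upwards [hω] with n hn t
    exact (not_le.1 fun h => hn ⟨t, h⟩).le
  · obtain ⟨K₁, h₁⟩ := exists_qvApprox_le (hpa n ω) hc
    obtain ⟨K₂, h₂⟩ := exists_qvApprox_le (hpb n ω) hc
    exact ⟨K₁ + K₂, fun t => (abs_sub _ _).trans (add_le_add (h₁ t) (h₂ t))⟩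

end PriceGame

theorem mainTheorem4 {T : ℝ} (hT : 0 < T) {ψ : ℝ → ℝ}
    (hψ_mono : MonotoneOn ψ (Set.Ici 0)) (hψ_pos : ∀ u : ℝ, 0 ≤ u → 0 < ψ u)
    (ι κ : ℕ → ℕ → PricePath T ψ → WithTop (Time T))
    (hι : IsDyadicType ι) (hκ : IsDyadicType κ) :
    ∃ r : ℝ, 0 < r ∧ r < 1 ∧
      Typically fun ω : PricePath T ψ =>
        (∃ A : Time T → ℝ,
          HasQuadraticVariation (fun n k => ι n k ω) ω A ∧
          HasQuadraticVariation (fun n k => κ n k ω) ω A) ∧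
        ∃ K : ℝ, ∀ (n : ℕ) (t : Time T),
          |qvApprox (fun k => ι n k ω) ω t - qvApprox (fun k => κ n k ω) ω t| ≤ K * r ^ n := by
  refine ⟨3 / 4, by norm_num, by norm_num, ?_⟩
  obtain ⟨C₁, hC₁, hf₁⟩ := hι.fine
  obtain ⟨C₂, hC₂, hf₂⟩ := hκ.fine
  set C := max C₁ C₂
  have hC : 0 ≤ C := hC₁.le.trans (le_max_left _ _)
  have hfι : ∀ n (ω : PricePath T ψ), IsFine (fun k => ι n k ω) ω (C / 2 ^ n) := fun n ω =>
    IsFine.mono (hf₁ ω n) (by gcongr; exact le_max_left _ _)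
  have hfκ : ∀ n (ω : PricePath T ψ), IsFine (fun k => κ n k ω) ω (C / 2 ^ n) := fun n ω =>
    IsFine.mono (hf₂ ω n) (by gcongr; exact le_max_right _ _)
  have hfι' : ∀ n (ω : PricePath T ψ), IsFine (fun k => ι (n + 1) k ω) ω (C / 2 ^ n) := fun n ω =>
    (hfι (n + 1) ω).mono (by gcongr <;> simp)
  have h₁ := isNull_frequently_qvDiff hT hψ_mono hψ_pos hι.isStoppingTime hκ.isStoppingTime
    hι.isPartition hκ.isPartition hC hfι hfκ
  -- Consecutive levels of `ι`, both fine at the coarser scale `C / 2 ^ n`.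
  have h₂ := isNull_frequently_qvDiff hT hψ_mono hψ_pos (a := fun n => ι (n + 1))
    (fun n => hι.isStoppingTime (n + 1)) hι.isStoppingTime (fun n => hι.isPartition (n + 1))
    hι.isPartition hC hfι' hfι
  -- Two null sets as a countable family: index `0` carries `h₁` and every positive index carries
  -- `h₂`.
  refine (isNull_iUnion hT.le fun n : ℕ => Nat.casesOn (motive := fun n => IsNull (Nat.casesOn
    (motive := fun _ => Set (PricePath T ψ)) n _ fun _ => _)) n h₁ fun _ => h₂).mono fun ω hω => ?_
  by_contra hnot
  simp only [Set.mem_iUnion, not_exists] at hnot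
  refine hω ?_
  obtain ⟨K, hK⟩ := exists_abs_qvDiff_le hι.isPartition hκ.isPartition hC hfι (hnot 0)
  obtain ⟨K', hK'⟩ := exists_abs_qvDiff_le (a := fun n => ι (n + 1))
    (fun n => hι.isPartition (n + 1)) hι.isPartition hC hfι' (hnot 1)
  obtain ⟨A, hA⟩ := exists_tendstoUniformly_of_geometric (F := fun n => qvApprox (fun k => ι n k ω)
    ω) (by norm_num) (by norm_num) hK'
  have hcad : IsCadlag A :=
    IsCadlag.of_tendstoUniformly hA fun n => isCadlag_qvApprox (hι.isPartition n ω) ω.cadlag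
  refine ⟨⟨A, ⟨hcad, hA⟩, hcad, ?_⟩, K, hK⟩
  have hlim : Tendsto (fun n : ℕ => K * (3 / 4 : ℝ) ^ n) atTop (𝓝 0) := by
    simpa using (tendsto_pow_atTop_nhds_zero_of_lt_one (by norm_num : (0 : ℝ) ≤ 3 / 4)
      (by norm_num)).const_mul K
  refine Metric.tendstoUniformly_iff.2 fun ε hε => ?_
  filter_upwards [Metric.tendstoUniformly_iff.1 hA (ε / 2) (by positivity),
    (tendsto_order.1 hlim).2 (ε / 2) (by positivity)] with n h1 h2 t
  have h3 : dist (qvApprox (fun k => ι n k ω) ω t) (qvApprox (fun k => κ n k ω) ω t) < ε / 2 :=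
    (hK n t).trans_lt h2
  linarith [h1 t, dist_triangle (A t) (qvApprox (fun k => ι n k ω) ω t)
    (qvApprox (fun k => κ n k ω) ω t)]
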